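/- **Standard phase estimation.** Let $n\in\mathbb{Z}^+$, $\alpha\in(0,1)$ and $\delta>0$. A unitary $U$ on $\mathbb{C}^D$ satisfies an $(n,\alpha)$-rounding promise if $U=\sum_j e^{2\pi i\lambda_j}|\psi_j\rangle\langle\psi_j|$ for an orthonormal basis $(\psi_j)$ and phases $\lambda_j\in[0,1)$ with $\lambda_j\notin\left[\frac{x}{2^n},\frac{x}{2^n}+\frac{\alpha}{2^n}\right]$ for all $x\in\{0,\dots,2^n\}$. A phase estimator with phases and $m$ qubits of garbage is a protocol that, given $n,\alpha,\delta$, produces a quantum circuit (independent of $U$) built from fixed gates on work qubits initialised to $|0\rangle$ and controlled calls to $U$ and $U^\dagger$, such that for every finite-dimensional $U$ with an $(n,\alpha)$-rounding promise there are phases $\varphi_j\in\mathbb{R}$ and normalized $m$-qubit states $|\mathrm{gar}_j\rangle$ for which the channel implemented by the circuit is $\delta$-close in diamond norm, $|\Lambda|_\diamond=\sup_\rho|(\Lambda\otimes\mathcal I)(\rho)|_1$, to the map $$|0^n\rangle|0\dots0\rangle|\psi_j\rangle\mapsto e^{i\varphi_j}\,|\lfloor 2^n\lambda_j\rfloor\rangle\,|\mathrm{gar}_j\rangle\,|\psi_j\rangle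 .$$ Its query complexity is the number of calls to controlled $U$ and $U^\dagger$ in the circuit. Let $$\gamma(x)=\frac{\sin^2(\pi x)}{\pi^2x^2},\qquad \eta_0=\frac{8}{\pi^2}-\frac12,\qquad \delta_{\mathrm{med}}=\frac{\delta^2}{6.25},\qquad r=\begin{cases}\left\lceil\log_2\frac{1}{2\alpha}\right\rceil&\alpha\le\frac12,\\0&\alpha>\frac12,\end{cases}\qquad \eta=\begin{cases}\eta_0&\alpha\le\frac12,\\ \gamma\!\left(\frac{1-\alpha}{2}\right)-\frac12&\alpha>\frac12,\end{cases}$$ and $M=\left\lceil\frac{\ln(\delta_{\mathrm{med}}^{-1})}{2\eta^2}\right\rceil$ (read as $0$ if the quotient is negative, i.e. if $\delta>2.5$). Consider the following protocol. On each of $M$ registers of $n+r$ qubits, in turn: prepare the uniform superposition over $t\in\{0,\dots,2^{n+r}-1\}$ by Hadamard gates; apply $U^t$ to the system by controlled applications of $U$ ($2^i$ of them controlled on the qubit of weight $2^i$); multiply $|t\rangle$ by $e^{-2\pi i t s/2^{n+r}}$ with $s=\frac{1+2^r\alpha}{2}$; apply the inverse quantum Fourier transform. Then drop the $r$ least significant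 bits of each of the $M$ outcomes and copy the median of the resulting $n$-bit numbers into the $n$-qubit output register; the $M$ registers are the garbage. This protocol is a phase estimator with phases and garbage, and for all $n\in\mathbb{Z}^+$, $\alpha\in(0,1)$, $\delta>0$: 1. If $\alpha\le\frac12$, it has query complexity $(2^{n+r}-1)\left\lceil\frac{\ln(\delta_{\mathrm{med}}^{-1})}{2\eta_0^2}\right\rceil$ and $(n+r)\left\lceil\frac{\ln(\delta_{\mathrm{med}}^{-1})}{2\eta_0^2}\right\rceil$ qubits of garbage. 2. If $\alpha>\frac12$, it has query complexity $(2^{n}-1)\left\lceil\frac{\ln(\delta_{\mathrm{med}}^{-1})}{2\eta^2}\right\rceil$ and $n\left\lceil\frac{\ln(\delta_{\mathrm{med}}^{-1})}{2\eta^2}\right\rceil$ qubits of garbage. -/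

import Mathlib

open scoped Kronecker ComplexOrder

noncomputable section

namespace PhaseEstimation

/-! ### Trace norm and diamond norm -/

/-- The trace norm of a square complex matrix: the sum of its singular values. -/
def traceNorm {m : Type*} [Fintype m] [DecidableEq m] (A : Matrix m m ℂ) : ℝ :=
  ∑ i ∈ Finset.range (Fintype.card m), (Matrix.toEuclideanLin A).singularValues i

/-- `ρ` is a density matrix. -/
def IsDensity {m : Type*} [Fintype m] (ρ : Matrix m m ℂ) : Prop :=
  ρ.PosSemidef ∧ ρ.trace = 1

/-- `Λ ⊗ id` on a system extended by a `k`-dimensional reference system. -/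
def extend {a b : Type*} (Λ : Matrix a a ℂ →ₗ[ℂ] Matrix b b ℂ) (k : ℕ)
    (X : Matrix (a × Fin k) (a × Fin k) ℂ) : Matrix (b × Fin k) (b × Fin k) ℂ :=
  Matrix.of fun p q => Λ (Matrix.of fun i j => X (i, p.2) (j, q.2)) p.1 q.1

/-- The diamond norm `sup_ρ ‖(Λ ⊗ id)(ρ)‖₁`, over all density matrices `ρ` on the input system
extended by a reference system of arbitrary finite dimension. -/
def diamondNorm {a b : Type*} [Fintype a] [DecidableEq a] [Fintype b] [DecidableEq b]
    (Λ : Matrix a a ℂ →ₗ[ℂ] Matrix b b ℂ) : ENNReal :=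
  ⨆ (k : ℕ) (ρ : Matrix (a × Fin k) (a × Fin k) ℂ) (_ : IsDensity ρ),
    ENNReal.ofReal (traceNorm (extend Λ k ρ))

/-! ### Quantum circuits with controlled queries to a unitary -/

/-- Computational basis states of a register whose qubits are indexed by `Q`. -/
abbrev Bits (Q : Type*) := Q → Bool

/-- A gate of a circuit on work qubits `Q` and a system register. Gates of the first two kinds act
on the work qubits alone; the other two are the queries, controlled on a work qubit. -/
inductive Gate (Q : Type) where
  /-- a fixed unitary applied to the qubits `e 0, …, e (k - 1)` -/
  | localUnitary {k : ℕ} (e : Fin k ↪ Q) (V : Matrix.unitaryGroup (Bits (Fin k)) ℂ) : Gate Q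
  /-- a reversible classical computation `|z⟩ ↦ |π z⟩` -/
  | reversible (π : Equiv.Perm (Bits Q)) : Gate Q
  /-- controlled `U` -/
  | ctrl (q : Q) : Gate Q
  /-- controlled `U†` -/
  | ctrlDagger (q : Q) : Gate Q

/-- `U` applied to the system register if work qubit `q` is in state `|1⟩`. -/
def controlled {Q d : Type*} [DecidableEq Q] [Fintype Q] [DecidableEq d]
    (q : Q) (U : Matrix d d ℂ) : Matrix (Bits Q × d) (Bits Q × d) ℂ :=
  Matrix.diagonal (fun z : Bits Q => if z q then (1 : ℂ) else 0) ⊗ₖ U +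
    Matrix.diagonal (fun z : Bits Q => if z q then (0 : ℂ) else 1) ⊗ₖ (1 : Matrix d d ℂ)

open Classical in
/-- The operator on `Q` that applies `V` to the qubits `e 0, …, e (k - 1)`. -/
def onQubits {Q : Type*} {k : ℕ} (e : Fin k ↪ Q)
    (V : Matrix (Bits (Fin k)) (Bits (Fin k)) ℂ) : Matrix (Bits Q) (Bits Q) ℂ :=
  Matrix.of fun x y => if ∀ q, q ∉ Set.range e → x q = y q then V (x ∘ e) (y ∘ e) else 0

/-- The operator implemented by a gate when the queried unitary is `U`. -/
def Gate.toMatrix {Q d : Type} [DecidableEq Q] [Fintype Q] [DecidableEq d] [Fintype d]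
    (U : Matrix d d ℂ) : Gate Q → Matrix (Bits Q × d) (Bits Q × d) ℂ
  | .localUnitary e V => onQubits e V.1 ⊗ₖ (1 : Matrix d d ℂ)
  | .reversible π => (Matrix.of fun x y => if x = π y then (1 : ℂ) else 0) ⊗ₖ (1 : Matrix d d ℂ)
  | .ctrl q => controlled q U
  | .ctrlDagger q => controlled q U.conjTranspose

/-- The operator implemented by a list of gates, applied from left to right. -/
def gatesMatrix {Q d : Type} [DecidableEq Q] [Fintype Q] [DecidableEq d] [Fintype d]
    (U : Matrix d d ℂ) : List (Gate Q) → Matrix (Bits Q × d) (Bits Q × d) ℂ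
  | [] => 1
  | g :: gs => gatesMatrix U gs * g.toMatrix U

/-- Whether a gate is a query to the controlled unitary or its inverse. -/
def Gate.isQuery {Q : Type} : Gate Q → Bool
  | .localUnitary _ _ => false
  | .reversible _ => false
  | .ctrl _ => true
  | .ctrlDagger _ => true

/-- A circuit for `n`-bit estimation: `n` output qubits, `garbage` qubits that are kept, `ancilla`
qubits that are discarded at the end, and a list of gates. All work qubits start in `|0⟩`. -/
structure EstimationCircuit (n : ℕ) where
  garbage : ℕ
  ancilla : ℕ
  gates : List (Gate (Fin n ⊕ Fin garbage ⊕ Fin ancilla))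

/-- The number of queries made by a circuit. -/
def EstimationCircuit.queries {n : ℕ} (C : EstimationCircuit n) : ℕ :=
  C.gates.countP Gate.isQuery

/-- Basis of the output of an estimator: the answer, the garbage, and the system. -/
abbrev Out (n m : ℕ) (d : Type*) := (Bits (Fin n) × Bits (Fin m)) × d

/-- The channel `σ ↦ W σ W†`. -/
def conjChannel {a b : Type*} [Fintype a] (W : Matrix b a ℂ) :
    Matrix a a ℂ →ₗ[ℂ] Matrix b b ℂ where
  toFun σ := W * σ * W.conjTranspose
  map_add' σ τ := by rw [Matrix.mul_add, Matrix.add_mul]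
  map_smul' c σ := by simp

/-- Appending work qubits in state `|0…0⟩` and then running the circuit. -/
def EstimationCircuit.run {n : ℕ} {d : Type} [DecidableEq d] [Fintype d]
    (C : EstimationCircuit n) (U : Matrix d d ℂ) :
    Matrix (Bits (Fin n ⊕ Fin C.garbage ⊕ Fin C.ancilla) × d) d ℂ :=
  gatesMatrix U C.gates *
    Matrix.of fun p j => if p.1 = (fun _ => false) ∧ p.2 = j then (1 : ℂ) else 0

/-- Tracing out the ancilla qubits. -/
def discard (n m a : ℕ) (d : Type) :
    Matrix (Bits (Fin n ⊕ Fin m ⊕ Fin a) × d) (Bits (Fin n ⊕ Fin m ⊕ Fin a) × d) ℂ →ₗ[ℂ]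
      Matrix (Out n m d) (Out n m d) ℂ where
  toFun X := Matrix.of fun p q => ∑ c : Bits (Fin a),
    X (Sum.elim p.1.1 (Sum.elim p.1.2 c), p.2) (Sum.elim q.1.1 (Sum.elim q.1.2 c), q.2)
  map_add' X Y := by
    ext p q
    simp [Finset.sum_add_distrib]
  map_smul' c X := by
    ext p q
    simp [Finset.mul_sum]

/-- The quantum channel from the system to answer, garbage and system that is implemented by a
circuit when the queried unitary is `U`. -/
def EstimationCircuit.channel {n : ℕ} {d : Type} [DecidableEq d] [Fintype d]
    (C : EstimationCircuit n) (U : Matrix d d ℂ) :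
    Matrix d d ℂ →ₗ[ℂ] Matrix (Out n C.garbage d) (Out n C.garbage d) ℂ :=
  discard n C.garbage C.ancilla d ∘ₗ conjChannel (C.run U)

/-! ### Rounding promise and phase estimators -/

/-- `U = ∑ j, exp (2 π i λ j) |ψ j⟩⟨ψ j|` for the orthonormal basis `ψ`, with phases in `[0, 1)`
that avoid `[x / 2 ^ n, x / 2 ^ n + α / 2 ^ n]` for all `x ∈ {0, …, 2 ^ n}`. -/
structure RoundingPromise (n : ℕ) (α : ℝ) {D : ℕ} (U : Matrix (Fin D) (Fin D) ℂ)
    (ψ : OrthonormalBasis (Fin D) ℂ (EuclideanSpace ℂ (Fin D))) (lam : Fin D → ℝ) : Prop where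
  decomposition : U = ∑ j, Complex.exp (2 * Real.pi * Complex.I * lam j) •
    Matrix.vecMulVec (fun i => ψ j i) (fun i => star (ψ j i))
  range : ∀ j, lam j ∈ Set.Ico (0 : ℝ) 1
  avoids : ∀ j, ∀ x : ℕ, x ≤ 2 ^ n →
    lam j ∉ Set.Icc ((x : ℝ) / 2 ^ n) ((x : ℝ) / 2 ^ n + α / 2 ^ n)

/-- The binary encoding of a natural number on `n` qubits. -/
def encode (n x : ℕ) : Bits (Fin n) := fun i => x.testBit i

/-- The isometry `|ψ j⟩ ↦ exp (i φ j) |⌊2 ^ n λ j⌋⟩ |gar j⟩ |ψ j⟩`. -/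
def idealIsometry (n m : ℕ) {D : ℕ} (ψ : OrthonormalBasis (Fin D) ℂ (EuclideanSpace ℂ (Fin D)))
    (lam φ : Fin D → ℝ) (gar : Fin D → EuclideanSpace ℂ (Bits (Fin m))) :
    Matrix (Out n m (Fin D)) (Fin D) ℂ :=
  ∑ j, Complex.exp (Complex.I * φ j) • Matrix.vecMulVec
    (fun p => (if p.1.1 = encode n ⌊2 ^ n * lam j⌋₊ then (1 : ℂ) else 0) * gar j p.1.2 * ψ j p.2)
    (fun i => star (ψ j i))

/-- An estimation protocol produces a circuit from `n`, `α`, `δ`, without reference to `U`. -/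
abbrev Protocol := (n : ℕ) → (α δ : ℝ) → EstimationCircuit n

/-- The protocol is a phase estimator with phases and garbage: on every unitary that satisfies an
`(n, α)`-rounding promise, its circuit is `δ`-close in diamond norm to the map
`|0…0⟩ |0…0⟩ |ψ j⟩ ↦ exp (i φ j) |⌊2 ^ n λ j⌋⟩ |gar j⟩ |ψ j⟩` for some phases and some normalized
garbage states. -/
def IsPhaseEstimatorWithPhasesAndGarbage (P : Protocol) : Prop :=
  ∀ (n : ℕ) (α δ : ℝ), 1 ≤ n → 0 < α → α < 1 → 0 < δ →
    ∀ (D : ℕ) (U : Matrix (Fin D) (Fin D) ℂ)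
      (ψ : OrthonormalBasis (Fin D) ℂ (EuclideanSpace ℂ (Fin D))) (lam : Fin D → ℝ),
      RoundingPromise n α U ψ lam →
      ∃ (φ : Fin D → ℝ) (gar : Fin D → EuclideanSpace ℂ (Bits (Fin (P n α δ).garbage))),
        (∀ j, ‖gar j‖ = 1) ∧
        diamondNorm ((P n α δ).channel U -
          conjChannel (idealIsometry n (P n α δ).garbage ψ lam φ gar)) ≤ ENNReal.ofReal δ

/-! ### The parameters of standard phase estimation -/

/-- `γ(x) = sin² (π x) / (π² x²)` -/
def gam (x : ℝ) : ℝ := Real.sin (Real.pi * x) ^ 2 / (Real.pi ^ 2 * x ^ 2)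

/-- `η₀ = 8 / π² - 1 / 2` -/
def etaZero : ℝ := 8 / Real.pi ^ 2 - 1 / 2

/-- `δ_med = δ² / 6.25` -/
def deltaMed (δ : ℝ) : ℝ := δ ^ 2 / 6.25

/-- `r = ⌈log₂ (1 / (2 α))⌉`, the number of additional bits; it is `0` for `1 / 2 ≤ α < 1`. -/
def extraBits (α : ℝ) : ℕ := ⌈Real.logb 2 (1 / (2 * α))⌉₊

/-- `⌈ln (δ_med⁻¹) / (2 η²)⌉`, the number of estimates for amplification gap `η`
(no estimates if the quotient is negative, which requires `δ > 2.5`). -/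
def repetitions (η δ : ℝ) : ℕ := ⌈Real.log (deltaMed δ)⁻¹ / (2 * η ^ 2)⌉₊

/-- The amplification gap. -/
def gap (α : ℝ) : ℝ := if α ≤ 1 / 2 then etaZero else gam ((1 - α) / 2) - 1 / 2

/-! ### The gates of standard phase estimation -/

/-- A qubit state is a `Bits (Fin 1)`; the Hadamard gate. -/
def hadamardMatrix : Matrix (Bits (Fin 1)) (Bits (Fin 1)) ℂ :=
  Matrix.of fun x y => (if x 0 && y 0 then -1 else 1) / (Real.sqrt 2 : ℂ)

/-- The diagonal gate `|t⟩ ↦ exp (-2 π i t s / 2 ^ b) |t⟩` on `b` qubits. -/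
def shiftMatrix (b : ℕ) (s : ℝ) : Matrix (Bits (Fin b)) (Bits (Fin b)) ℂ :=
  Matrix.diagonal fun t => Complex.exp (-(2 * Real.pi * Nat.ofBits t * s / 2 ^ b : ℝ) * Complex.I)

/-- The inverse quantum Fourier transform on `b` qubits. -/
def inverseQFTMatrix (b : ℕ) : Matrix (Bits (Fin b)) (Bits (Fin b)) ℂ :=
  Matrix.of fun x t => Complex.exp
    (-(2 * Real.pi * Nat.ofBits t * Nat.ofBits x / 2 ^ b : ℝ) * Complex.I) / (Real.sqrt (2 ^ b) : ℂ)

theorem hadamardMatrix_mem : hadamardMatrix ∈ Matrix.unitaryGroup (Bits (Fin 1)) ℂ := by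
  rw [Matrix.mem_unitaryGroup_iff]
  have h2 : (Real.sqrt 2 : ℂ) * Real.sqrt 2 = 2 := by
    rw [← Complex.ofReal_mul, Real.mul_self_sqrt (by norm_num)]
    norm_num
  have h0 : (Real.sqrt 2 : ℂ) ≠ 0 := by
    intro h
    rw [h] at h2
    norm_num at h2
  have hb : ∀ v : Bits (Fin 1), v = (fun _ => v 0) := fun v => by
    ext i
    rw [Subsingleton.elim i 0]
  have hne : (fun _ : Fin 1 => false) ≠ fun _ => true := fun h => by simpa using congrFun h 0
  have huniv : (Finset.univ : Finset (Bits (Fin 1))) = {fun _ => false, fun _ => true} := by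
    ext v
    rw [hb v]
    cases v 0 <;> simp
  ext x y
  rw [Matrix.mul_apply, huniv, Finset.sum_pair hne, hb x, hb y]
  cases x 0 <;> cases y 0 <;>
    simp [hadamardMatrix, Matrix.star_apply, hne, hne.symm] <;> field_simp <;>
    simp [sq, h2] <;> norm_num

theorem shiftMatrix_mem (b : ℕ) (s : ℝ) :
    shiftMatrix b s ∈ Matrix.unitaryGroup (Bits (Fin b)) ℂ := by
  rw [Matrix.mem_unitaryGroup_iff, shiftMatrix, Matrix.star_eq_conjTranspose,
    Matrix.diagonal_conjTranspose, Matrix.diagonal_mul_diagonal, ← Matrix.diagonal_one]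
  congr 1
  ext t
  rw [Pi.star_apply, RCLike.star_def, Complex.mul_conj, Complex.normSq_eq_norm_sq,
    ← Complex.ofReal_neg, Complex.norm_exp_ofReal_mul_I]
  norm_num

theorem ofBits_bijective (b : ℕ) : Function.Bijective
    (fun x : Bits (Fin b) => (⟨Nat.ofBits x, Nat.ofBits_lt_two_pow x⟩ : Fin (2 ^ b))) := by
  rw [Fintype.bijective_iff_injective_and_card]
  refine ⟨fun x y h => ?_, by simp⟩
  ext i
  have h' : Nat.ofBits x = Nat.ofBits y := by simpa using h
  have := congrArg (fun k => k.testBit i) h'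
  simpa using this

theorem inverseQFTMatrix_mem (b : ℕ) :
    inverseQFTMatrix b ∈ Matrix.unitaryGroup (Bits (Fin b)) ℂ := by
  rw [Matrix.mem_unitaryGroup_iff]
  ext x y
  have hN : (2 : ℂ) ^ b ≠ 0 := by positivity
  have hs : (Real.sqrt (2 ^ b) : ℂ) * Real.sqrt (2 ^ b) = 2 ^ b := by
    rw [← Complex.ofReal_mul, Real.mul_self_sqrt (by positivity)]
    norm_num
  set w : ℂ := Complex.exp
    (2 * Real.pi * Complex.I * (((Nat.ofBits y : ℂ) - Nat.ofBits x) / 2 ^ b)) with hw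
  have hterm : ∀ t : Bits (Fin b), inverseQFTMatrix b x t * star (inverseQFTMatrix b) t y =
      w ^ Nat.ofBits t / 2 ^ b := by
    intro t
    rw [Matrix.star_apply, inverseQFTMatrix, Matrix.of_apply, Matrix.of_apply, RCLike.star_def,
      map_div₀, Complex.conj_ofReal, ← Complex.exp_conj, div_mul_div_comm, hs, ← Complex.exp_add,
      hw, ← Complex.exp_nat_mul]
    congr 2
    simp only [map_mul, map_neg, Complex.conj_I, Complex.conj_ofReal]
    push_cast
    field_simp
    ring
  rw [Matrix.mul_apply, Finset.sum_congr rfl fun t _ => hterm t, ← Finset.sum_div,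
    Matrix.one_apply]
  have hsum : ∑ t : Bits (Fin b), w ^ Nat.ofBits t = ∑ k ∈ Finset.range (2 ^ b), w ^ k := by
    rw [← Fin.sum_univ_eq_sum_range]
    exact (ofBits_bijective b).sum_comp (fun k : Fin (2 ^ b) => w ^ (k : ℕ))
  rw [hsum]
  split_ifs with h
  · have hw1 : w = 1 := by rw [hw, h]; simp
    rw [hw1]
    simp
  · have hw1 : w ≠ 1 := by
      intro h1
      rw [hw, Complex.exp_eq_one_iff] at h1
      obtain ⟨k, hk⟩ := h1
      have hp : (2 * Real.pi * Complex.I : ℂ) ≠ 0 := Complex.two_pi_I_ne_zero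
      rw [mul_comm (k : ℂ)] at hk
      have hk' := mul_left_cancel₀ hp hk
      rw [div_eq_iff hN] at hk'
      have hz : ((Nat.ofBits y : ℤ) - Nat.ofBits x) = k * 2 ^ b := by exact_mod_cast hk'
      have hx := Nat.ofBits_lt_two_pow x
      have hy := Nat.ofBits_lt_two_pow y
      have hz0 : ((Nat.ofBits y : ℤ) - Nat.ofBits x) = 0 := by
        refine Int.eq_zero_of_abs_lt_dvd (m := 2 ^ b) ⟨k, by rw [hz, mul_comm]⟩ ?_
        zify at hx hy
        rw [abs_lt]
        constructor <;> linarith [Int.natCast_nonneg (Nat.ofBits x), Int.natCast_nonneg (Nat.ofBits y)]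
      apply h
      apply (ofBits_bijective b).1
      apply Fin.ext
      change Nat.ofBits x = Nat.ofBits y
      omega
    have hwN : w ^ (2 ^ b) = 1 := by
      rw [hw, ← Complex.exp_nat_mul, Complex.exp_eq_one_iff]
      refine ⟨(Nat.ofBits y : ℤ) - Nat.ofBits x, ?_⟩
      push_cast
      field_simp
    rw [geom_sum_eq hw1, hwN]
    simp

/-- The (lower) median of `M` natural numbers: the least `x` such that at least half of the numbers
are at most `x`. -/
def median {M : ℕ} (v : Fin M → ℕ) : ℕ :=
  sInf {x | M ≤ 2 * (Finset.univ.filter fun l => v l ≤ x).card}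

/-- Qubit `i` of the `l`-th of the `M` estimate registers of `b` qubits each. -/
def estimateQubit (n M b : ℕ) (l : Fin M) : Fin b ↪ Fin n ⊕ Fin (M * b) ⊕ Fin 0 where
  toFun i := Sum.inr (Sum.inl (finProdFinEquiv (l, i)))
  inj' i j h := by simpa using h

/-- The number held by the `l`-th estimate register, without its `r` least significant bits. -/
def estimate (n M b r : ℕ) (z : Bits (Fin n ⊕ Fin (M * b) ⊕ Fin 0)) (l : Fin M) : ℕ :=
  Nat.ofBits (fun i => z (estimateQubit n M b l i)) / 2 ^ r

/-- Adding (bitwise) the median of the estimates to the output register. -/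
def copyMedian (n M b r : ℕ) : Equiv.Perm (Bits (Fin n ⊕ Fin (M * b) ⊕ Fin 0)) :=
  Function.Involutive.toPerm
    (fun z => Sum.elim
      (fun i => xor (z (Sum.inl i)) (encode n (median (estimate n M b r z)) i))
      (fun q => z (Sum.inr q)))
    (by
      intro z
      have h : ∀ v : Bits (Fin n), estimate n M b r (Sum.elim v (fun q => z (Sum.inr q))) =
          estimate n M b r z := fun v => rfl
      ext q
      rcases q with i | q
      · simp [h]
      · rfl)

/-- One run of phase estimation on the `l`-th estimate register: a uniform superposition over
times `t`, the power `U ^ t` controlled on the register (for the qubit of weight `2 ^ i`, by `2 ^ i`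
controlled applications of `U`), a phase shift that accounts for flooring, and an inverse quantum
Fourier transform. -/
def estimateGates (n M b : ℕ) (s : ℝ) (l : Fin M) :
    List (Gate (Fin n ⊕ Fin (M * b) ⊕ Fin 0)) :=
  ((List.finRange b).map fun i =>
      Gate.localUnitary ⟨fun _ : Fin 1 => estimateQubit n M b l i, fun _ _ _ => Subsingleton.elim _ _⟩
        ⟨hadamardMatrix, hadamardMatrix_mem⟩) ++
  ((List.finRange b).flatMap fun i : Fin b =>
      List.replicate (2 ^ i.val) (Gate.ctrl (estimateQubit n M b l i))) ++
  [Gate.localUnitary (estimateQubit n M b l) ⟨shiftMatrix b s, shiftMatrix_mem b s⟩,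
   Gate.localUnitary (estimateQubit n M b l) ⟨inverseQFTMatrix b, inverseQFTMatrix_mem b⟩]

/-- Standard phase estimation: `M` estimates of `n + r` bits each, whose `r` least significant bits
are then ignored, and the median of the resulting `n`-bit estimates. The phase shift
`(1 + 2 ^ r α) / 2` puts the centre of the allowed part of a bin at an exact outcome of the
Fourier transform. -/
def standardPhaseEstimation : Protocol := fun n α δ =>
  let r := extraBits α
  let M := repetitions (gap α) δ
  { garbage := M * (n + r)
    ancilla := 0
    gates :=
      (List.finRange M).flatMap (estimateGates n M (n + r) ((1 + 2 ^ r * α) / 2)) ++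
        [Gate.reversible (copyMedian n M (n + r) r)] }

end PhaseEstimation

end

namespace PhaseEstimation

/-! Every query acts on an eigenvector ψ_j as a phase ω_j = exp(2πiλ_j) on the work qubits. The
circuit therefore implements conjugation by an isometry sending ψ_j to w_j ⊗ ψ_j with w_j explicit
(`channel_standardPhaseEstimation`). The ideal map has the same shape with vectors v_j, and for two
such isometries W, V the matrix (W - V)†(W - V) is diagonal in the eigenbasis with entries ‖w_j -
v_j‖². Writing ρ = SS†, Cauchy–Schwarz for Frobenius norms bounds the diamond distance by 2 max_j
‖w_j - v_j‖ (`diamondNorm_conjChannel_sub_le`), so it suffices to treat each eigenvector alone.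

For one register of b = n + r qubits the amplitude of outcome x is a geometric sum, and its squared
modulus is at least sinc²(π(2^b λ - s - x)). The promise confines 2^b λ to the upper part of a bin
of length 2^r, and subtracting s centres that part on the 2^r outcomes of the bin. Hence the correct
n bits appear with probability at least 1/2 + η (`half_add_gap_le_hitProb`): either the shifted
phase lies between two outcomes of the bin, which jointly have probability at least 8/π², or it is
close to a single one.

The median can fail only without a strict majority of correct estimates, which by Chernoff has
probability at most exp(-2η²M) ≤ δ_med (`median_failure_le`). As garbage one takes the normalized
projection of the joint register state onto the correct median (`exists_normalized_projection`). It
absorbs all phases, so φ_j = 0 works. The squared distance is at most 1.5625 δ_med = δ²/4, giving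
diamond distance at most δ. This is needed only for δ < 2, since two isometric channels never differ
by more than 2. -/

/-! ### Trace norm and Frobenius norms -/

-- A singular value decomposition in variational form: b diagonalizes T†T, and u i is T (b i)
-- divided by its singular value. Only Bessel's inequality is kept for u, which suffices for
-- Cauchy–Schwarz.
open Module in
theorem exists_sum_singularValues_eq {E : Type*} [NormedAddCommGroup E] [InnerProductSpace ℂ E]
    [FiniteDimensional ℂ E] (T : E →ₗ[ℂ] E) {n : ℕ} (hn : finrank ℂ E = n) :
    ∃ (b : OrthonormalBasis (Fin n) ℂ E) (u : Fin n → E),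
      (∀ w, ∑ i, ‖inner ℂ (u i) w‖ ^ 2 ≤ ‖w‖ ^ 2) ∧
      ∑ i ∈ Finset.range n, T.singularValues i = ∑ i, (inner ℂ (u i) (T (b i))).re := by
  have hs := T.isSymmetric_adjoint_comp_self
  let b := hs.eigenvectorBasis hn
  let σ : Fin n → ℝ := fun i => T.singularValues i
  have hin : ∀ i j, inner ℂ (T (b i)) (T (b j)) = if i = j then ((σ i : ℂ)) ^ 2 else 0 := by
    intro i j
    have h1 : (LinearMap.adjoint T ∘ₗ T) (b i) = (((σ i) ^ 2 : ℝ) : ℂ) • b i := by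
      rw [hs.apply_eigenvectorBasis hn i, ← T.sq_singularValues_fin hn i]
      rfl
    rw [← LinearMap.adjoint_inner_left]
    change inner ℂ ((LinearMap.adjoint T ∘ₗ T) (b i)) (b j) = _
    rw [h1, inner_smul_left, orthonormal_iff_ite.1 b.orthonormal i j]
    split_ifs <;> simp
  -- Where σ i = 0 the inverse is 0, so u i = 0; the nonzero u i are orthonormal, and Bessel
  -- survives the extra zeros.
  let u : Fin n → E := fun i => ((σ i)⁻¹ : ℂ) • T (b i)
  have hu : Orthonormal ℂ (fun i : {i // σ i ≠ 0} => u i) := by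
    rw [orthonormal_iff_ite]
    rintro ⟨i, hi⟩ ⟨j, hj⟩
    have hi' : (σ i : ℂ) ≠ 0 := by exact_mod_cast hi
    simp only [u, inner_smul_left, inner_smul_right, hin, Subtype.mk.injEq]
    split_ifs with h
    · subst h
      simp only [map_inv₀, Complex.conj_ofReal]
      field_simp
    · simp
  refine ⟨b, u, fun w => ?_, ?_⟩
  · calc ∑ i, ‖inner ℂ (u i) w‖ ^ 2 = ∑ i : {i // σ i ≠ 0}, ‖inner ℂ (u i) w‖ ^ 2 := by
          rw [← Finset.sum_subtype (Finset.univ.filter fun i => σ i ≠ 0) (by simp)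
            (fun i => ‖inner ℂ (u i) w‖ ^ 2)]
          refine (Finset.sum_subset (Finset.filter_subset _ _) fun i _ hi => ?_).symm
          have : σ i = 0 := by simpa using hi
          simp [u, this]
      _ ≤ ‖w‖ ^ 2 := hu.sum_inner_products_le w
  · rw [Finset.sum_range]
    refine Finset.sum_congr rfl fun i _ => ?_
    simp only [u, inner_smul_left, hin, if_true]
    rw [map_inv₀, Complex.conj_ofReal]
    by_cases h : σ i = 0
    · simp [h]; exact h
    · have hi' : (σ i : ℂ) ≠ 0 := by exact_mod_cast h
      rw [show ((σ i : ℂ))⁻¹ * (σ i) ^ 2 = σ i by field_simp, Complex.ofReal_re]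

/-- The squared Frobenius norm. -/
noncomputable def frobSq {m k : Type*} [Fintype m] [Fintype k] (A : Matrix m k ℂ) : ℝ :=
  ∑ i, ∑ j, ‖A i j‖ ^ 2

section Frobenius

variable {m k : Type*} [Fintype m] [Fintype k]

theorem frobSq_eq_trace (A : Matrix m k ℂ) : (frobSq A : ℂ) = (A.conjTranspose * A).trace := by
  rw [Matrix.trace, frobSq, Finset.sum_comm]
  push_cast
  refine Finset.sum_congr rfl fun j _ => ?_
  rw [Matrix.diag_apply, Matrix.mul_apply]
  refine Finset.sum_congr rfl fun i _ => ?_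
  rw [Matrix.conjTranspose_apply, RCLike.star_def, Complex.conj_mul']

theorem frobSq_neg (A : Matrix m k ℂ) : frobSq (-A) = frobSq A := by simp [frobSq]

theorem sum_inner_col_le {ι : Type*} [Fintype ι] (A : Matrix m k ℂ) (u : ι → EuclideanSpace ℂ m)
    (hu : ∀ w, ∑ i, ‖inner ℂ (u i) w‖ ^ 2 ≤ ‖w‖ ^ 2) :
    ∑ i, ∑ j, ‖inner ℂ (u i) (WithLp.toLp 2 (A.col j))‖ ^ 2 ≤ frobSq A := by
  rw [frobSq, Finset.sum_comm, Finset.sum_comm (s := Finset.univ (α := m))]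
  refine Finset.sum_le_sum fun j _ => (hu _).trans_eq ?_
  rw [EuclideanSpace.norm_sq_eq]
  simp

variable [DecidableEq m]

/-- C E† is the sum of |C_j⟩⟨E_j| over columns. Cauchy–Schwarz over the pairs (i, j) separates C
from E, and Bessel turns each factor into a Frobenius norm. -/
theorem sum_inner_mul_conjTranspose_le {ι : Type*} [Fintype ι] (C E : Matrix m k ℂ)
    (b : OrthonormalBasis ι ℂ (EuclideanSpace ℂ m)) (u : ι → EuclideanSpace ℂ m)
    (hu : ∀ w, ∑ i, ‖inner ℂ (u i) w‖ ^ 2 ≤ ‖w‖ ^ 2) :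
    ∑ i, (inner ℂ (u i) (Matrix.toEuclideanLin (C * E.conjTranspose) (b i))).re ≤
      √(frobSq C) * √(frobSq E) := by
  have hb : ∀ w, ∑ i, ‖inner ℂ (b i) w‖ ^ 2 ≤ ‖w‖ ^ 2 := fun w =>
    b.orthonormal.sum_inner_products_le w
  have key : ∀ v : EuclideanSpace ℂ m, Matrix.toEuclideanLin (C * E.conjTranspose) v =
      ∑ j, inner ℂ (WithLp.toLp 2 (E.col j)) v • WithLp.toLp 2 (C.col j) := by
    intro v
    ext i
    simp only [Matrix.toLpLin_apply, Matrix.mulVec, dotProduct, Matrix.mul_apply,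
      WithLp.ofLp_sum, Finset.sum_apply, WithLp.ofLp_smul, Pi.smul_apply, smul_eq_mul,
      PiLp.inner_apply, RCLike.inner_apply, Matrix.col_apply, Matrix.conjTranspose_apply,
      Finset.sum_mul]
    rw [Finset.sum_comm]
    refine Finset.sum_congr rfl fun j _ => Finset.sum_congr rfl fun l _ => ?_
    rw [RCLike.star_def]
    ring
  calc ∑ i, (inner ℂ (u i) (Matrix.toEuclideanLin (C * E.conjTranspose) (b i))).re
      ≤ ∑ i, ∑ j, ‖inner ℂ (u i) (WithLp.toLp 2 (C.col j))‖ *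
          ‖inner ℂ (b i) (WithLp.toLp 2 (E.col j))‖ := by
        refine Finset.sum_le_sum fun i _ => (Complex.re_le_norm _).trans ?_
        rw [key, inner_sum]
        refine (norm_sum_le _ _).trans (Finset.sum_le_sum fun j _ => ?_)
        rw [inner_smul_right, norm_mul, mul_comm, norm_inner_symm (b i)]
    _ = ∑ p : ι × k, ‖inner ℂ (u p.1) (WithLp.toLp 2 (C.col p.2))‖ *
          ‖inner ℂ (b p.1) (WithLp.toLp 2 (E.col p.2))‖ := by rw [Fintype.sum_prod_type]
    _ ≤ _ := Real.sum_mul_le_sqrt_mul_sqrt _ _ _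
    _ ≤ _ := by
        rw [Fintype.sum_prod_type, Fintype.sum_prod_type]
        exact mul_le_mul (Real.sqrt_le_sqrt (sum_inner_col_le C u hu))
          (Real.sqrt_le_sqrt (sum_inner_col_le E b hb)) (Real.sqrt_nonneg _) (Real.sqrt_nonneg _)

/-- The pair (b, u) is chosen for the whole sum, so the bound splits by linearity and no triangle
inequality for the trace norm is required. -/
theorem traceNorm_le_frobSq (C E F G : Matrix m k ℂ) :
    traceNorm (C * E.conjTranspose + F * G.conjTranspose) ≤
      √(frobSq C) * √(frobSq E) + √(frobSq F) * √(frobSq G) := by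
  obtain ⟨b, u, hu, h⟩ := exists_sum_singularValues_eq
    (Matrix.toEuclideanLin (C * E.conjTranspose + F * G.conjTranspose))
    (finrank_euclideanSpace (𝕜 := ℂ) (ι := m))
  rw [traceNorm, h]
  simp only [map_add, LinearMap.add_apply, inner_add_right, Complex.add_re, Finset.sum_add_distrib]
  exact add_le_add (sum_inner_mul_conjTranspose_le C E b u hu)
    (sum_inner_mul_conjTranspose_le F G b u hu)

end Frobenius

/-! ### Diamond distance of two isometric channels -/

section Diamond

theorem sub_kronecker_one {a b : Type*} (A B : Matrix b a ℂ) (k : ℕ) :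
    (A - B) ⊗ₖ (1 : Matrix (Fin k) (Fin k) ℂ) = A ⊗ₖ (1 : Matrix (Fin k) (Fin k) ℂ) -
      B ⊗ₖ (1 : Matrix (Fin k) (Fin k) ℂ) := by
  ext
  simp [sub_mul]


theorem extend_conjChannel_sub {a b : Type*} [Fintype a] (W V : Matrix b a ℂ) (k : ℕ)
    (X : Matrix (a × Fin k) (a × Fin k) ℂ) :
    extend (conjChannel W - conjChannel V) k X =
      (W ⊗ₖ (1 : Matrix (Fin k) (Fin k) ℂ)) * X * (W ⊗ₖ (1 : Matrix (Fin k) (Fin k) ℂ)).conjTranspose -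
      (V ⊗ₖ (1 : Matrix (Fin k) (Fin k) ℂ)) * X *
        (V ⊗ₖ (1 : Matrix (Fin k) (Fin k) ℂ)).conjTranspose := by
  have h : ∀ (W : Matrix b a ℂ) (p q : b × Fin k),
      (W * (Matrix.of fun i j => X (i, p.2) (j, q.2)) * W.conjTranspose) p.1 q.1 =
      ((W ⊗ₖ (1 : Matrix (Fin k) (Fin k) ℂ)) * X *
        (W ⊗ₖ (1 : Matrix (Fin k) (Fin k) ℂ)).conjTranspose) p q := by
    intro W p q
    simp only [Matrix.mul_apply, Matrix.of_apply, Matrix.conjTranspose_apply,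
      Matrix.kroneckerMap_apply, Fintype.sum_prod_type, Matrix.one_apply, mul_ite, mul_one, mul_zero,
      ite_mul, zero_mul, Finset.sum_ite_eq, Finset.mem_univ, if_true, apply_ite star, star_zero]
  ext p q
  rw [Matrix.sub_apply, ← h, ← h]
  rfl

variable {a b : Type*} [Fintype a] [DecidableEq a] [Fintype b]

/-- The operator inequality W†W ≤ c survives tensoring with the reference identity; compress it by S
and take the trace. -/
theorem frobSq_kronecker_mul {k : ℕ} {c : ℝ} (W : Matrix b a ℂ)
    (hW : ((c : ℂ) • (1 : Matrix a a ℂ) - W.conjTranspose * W).PosSemidef)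
    (S : Matrix (a × Fin k) (a × Fin k) ℂ) (hS : frobSq S = 1) :
    frobSq ((W ⊗ₖ (1 : Matrix (Fin k) (Fin k) ℂ)) * S) ≤ c := by
  have h1 := (hW.kronecker (Matrix.PosSemidef.one (n := Fin k) (R := ℂ))).conjTranspose_mul_mul_same S
  have h2 := h1.trace_nonneg
  have h3 : (S.conjTranspose * ((c : ℂ) • (1 : Matrix a a ℂ) - W.conjTranspose * W) ⊗ₖ
      (1 : Matrix (Fin k) (Fin k) ℂ) * S).trace = ((c * frobSq S -
        frobSq ((W ⊗ₖ (1 : Matrix (Fin k) (Fin k) ℂ)) * S) : ℝ) : ℂ) := by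
    push_cast
    rw [frobSq_eq_trace, frobSq_eq_trace, Matrix.conjTranspose_mul, Matrix.conjTranspose_kronecker,
      sub_kronecker_one, Matrix.smul_kronecker, Matrix.one_kronecker_one, Matrix.mul_sub,
      Matrix.sub_mul, Matrix.trace_sub, Matrix.mul_smul, Matrix.smul_mul, Matrix.trace_smul,
      Matrix.mul_one, smul_eq_mul]
    congr 2
    have : (W.conjTranspose * W) ⊗ₖ (1 : Matrix (Fin k) (Fin k) ℂ) =
        (W.conjTranspose ⊗ₖ (1 : Matrix (Fin k) (Fin k) ℂ).conjTranspose) *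
          (W ⊗ₖ (1 : Matrix (Fin k) (Fin k) ℂ)) := by
      rw [← Matrix.mul_kronecker_mul, Matrix.conjTranspose_one, Matrix.one_mul]
    rw [this]
    simp only [Matrix.mul_assoc]
  rw [h3, hS] at h2
  have : (0 : ℝ) ≤ c * 1 - frobSq ((W ⊗ₖ (1 : Matrix (Fin k) (Fin k) ℂ)) * S) := by exact_mod_cast h2
  linarith

theorem exists_sqrt_of_isDensity {m : Type*} [Fintype m] [DecidableEq m] {ρ : Matrix m m ℂ}
    (h : IsDensity ρ) : ∃ S : Matrix m m ℂ, ρ = S * S.conjTranspose ∧ frobSq S = 1 := by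
  obtain ⟨B, hB⟩ : ∃ B : Matrix m m ℂ, ρ = B.conjTranspose * B := by
    open scoped MatrixOrder in
    exact CStarAlgebra.nonneg_iff_eq_star_mul_self.mp h.1.nonneg
  refine ⟨B.conjTranspose, by simpa using hB, ?_⟩
  have h1 := frobSq_eq_trace B.conjTranspose
  rw [Matrix.conjTranspose_conjTranspose, Matrix.trace_mul_comm, ← hB, h.2] at h1
  exact_mod_cast h1

variable [DecidableEq b]

theorem diamondNorm_conjChannel_sub_le_two (W V : Matrix b a ℂ) (hW : W.conjTranspose * W = 1)
    (hV : V.conjTranspose * V = 1) :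
    diamondNorm (conjChannel W - conjChannel V) ≤ ENNReal.ofReal 2 := by
  refine iSup_le fun k => iSup_le fun ρ => iSup_le fun hρ => ENNReal.ofReal_le_ofReal ?_
  obtain ⟨S, rfl, hS⟩ := exists_sqrt_of_isDensity hρ
  have hiso : ∀ W : Matrix b a ℂ, W.conjTranspose * W = 1 →
      √(frobSq ((W ⊗ₖ (1 : Matrix (Fin k) (Fin k) ℂ)) * S)) ≤ 1 := fun W h =>
    Real.sqrt_le_one.2 (frobSq_kronecker_mul (c := 1) W (by
      rw [h]; simpa using Matrix.PosSemidef.zero) S hS)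
  rw [extend_conjChannel_sub]
  set A := W ⊗ₖ (1 : Matrix (Fin k) (Fin k) ℂ)
  set B := V ⊗ₖ (1 : Matrix (Fin k) (Fin k) ℂ)
  have : A * (S * S.conjTranspose) * A.conjTranspose - B * (S * S.conjTranspose) * B.conjTranspose =
      (A * S) * (A * S).conjTranspose + (-(B * S)) * (B * S).conjTranspose := by
    simp only [Matrix.conjTranspose_mul, Matrix.mul_assoc, Matrix.neg_mul, sub_eq_add_neg]
  rw [this]
  refine (traceNorm_le_frobSq _ _ _ _).trans ?_
  rw [frobSq_neg]
  nlinarith [hiso W hW, hiso V hV, Real.sqrt_nonneg (frobSq (A * S)), Real.sqrt_nonneg (frobSq (B * S))]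

/-- With ρ = SS† and A, B the extensions of W, V, telescoping gives AρA† - BρB† = ((A - B)S)(AS)† +
(BS)((A - B)S)†. Each term has one factor of Frobenius norm at most √c and one of norm at most 1. -/
theorem diamondNorm_conjChannel_sub_le (W V : Matrix b a ℂ) (hW : W.conjTranspose * W = 1)
    (hV : V.conjTranspose * V = 1) {c : ℝ}
    (hc : ((c : ℂ) • (1 : Matrix a a ℂ) - (W - V).conjTranspose * (W - V)).PosSemidef) :
    diamondNorm (conjChannel W - conjChannel V) ≤ ENNReal.ofReal (2 * √c) := by
  refine iSup_le fun k => iSup_le fun ρ => iSup_le fun hρ => ENNReal.ofReal_le_ofReal ?_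
  obtain ⟨S, rfl, hS⟩ := exists_sqrt_of_isDensity hρ
  have hiso : ∀ W : Matrix b a ℂ, W.conjTranspose * W = 1 →
      √(frobSq ((W ⊗ₖ (1 : Matrix (Fin k) (Fin k) ℂ)) * S)) ≤ 1 := fun W h =>
    Real.sqrt_le_one.2 (frobSq_kronecker_mul (c := 1) W (by
      rw [h]; simpa using Matrix.PosSemidef.zero) S hS)
  have hdiff := Real.sqrt_le_sqrt (frobSq_kronecker_mul (W - V) hc S hS)
  rw [extend_conjChannel_sub]
  have hsub : (W - V) ⊗ₖ (1 : Matrix (Fin k) (Fin k) ℂ) = W ⊗ₖ (1 : Matrix (Fin k) (Fin k) ℂ) -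
      V ⊗ₖ (1 : Matrix (Fin k) (Fin k) ℂ) := sub_kronecker_one W V k
  rw [hsub] at hdiff
  set A := W ⊗ₖ (1 : Matrix (Fin k) (Fin k) ℂ)
  set B := V ⊗ₖ (1 : Matrix (Fin k) (Fin k) ℂ)
  have : A * (S * S.conjTranspose) * A.conjTranspose - B * (S * S.conjTranspose) * B.conjTranspose =
      ((A - B) * S) * (A * S).conjTranspose + (B * S) * ((A - B) * S).conjTranspose := by
    simp only [Matrix.conjTranspose_mul, Matrix.conjTranspose_sub, Matrix.mul_assoc, Matrix.sub_mul,
      Matrix.mul_sub]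
    abel
  rw [this]
  refine (traceNorm_le_frobSq _ _ _ _).trans ?_
  have h1 := hiso W hW
  have h2 := hiso V hV
  have h3 := Real.sqrt_nonneg (frobSq ((A - B) * S))
  have h4 := mul_le_mul hdiff h1 (Real.sqrt_nonneg _) (h3.trans hdiff)
  have h5 := mul_le_mul h2 hdiff h3 zero_le_one
  linarith

end Diamond

/-! ### Reduction to a single eigenvector -/

section Sectors

variable {D : ℕ} (ψ : OrthonormalBasis (Fin D) ℂ (EuclideanSpace ℂ (Fin D)))

/-- The operator `∑ j, (w j ⊗ ψ j) ⟨ψ j|`. -/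
noncomputable def sectorMap {κ : Type*} (w : Fin D → κ → ℂ) : Matrix (κ × Fin D) (Fin D) ℂ :=
  (Matrix.of fun p j => w j p.1 * ψ j p.2) * (Matrix.of fun j i => star (ψ j i))

theorem sum_star_mul_basis (j j' : Fin D) :
    ∑ i, star (ψ j i) * ψ j' i = if j = j' then 1 else 0 := by
  rw [← orthonormal_iff_ite.1 ψ.orthonormal j j', PiLp.inner_apply]
  refine Finset.sum_congr rfl fun i _ => ?_
  rw [RCLike.inner_apply, RCLike.star_def, mul_comm]

/-- Completeness follows from orthonormality, because a one-sided inverse of a square matrix is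
two-sided. -/
theorem sum_basis_mul_star (i i' : Fin D) :
    ∑ j, ψ j i * star (ψ j i') = if i = i' then 1 else 0 := by
  have h : (Matrix.of fun j i => star (ψ j i) : Matrix (Fin D) (Fin D) ℂ) *
      (Matrix.of fun i j => ψ j i) = 1 := by
    ext j j'
    rw [Matrix.mul_apply, Matrix.one_apply, ← sum_star_mul_basis ψ]
    rfl
  rw [mul_eq_one_comm] at h
  have h' := congrFun (congrFun h i) i'
  rwa [Matrix.mul_apply, Matrix.one_apply] at h'

theorem sectorMap_sub {κ : Type*} (w v : Fin D → κ → ℂ) :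
    sectorMap ψ w - sectorMap ψ v = sectorMap ψ (fun j x => w j x - v j x) := by
  rw [sectorMap, sectorMap, sectorMap, ← Matrix.sub_mul]
  congr 1
  ext p j
  simp [sub_mul]

/-- Orthogonality of the ψ j removes the cross terms whatever the w j are, leaving only their
squared norms on the diagonal. Isometry and the operator bound on a difference both follow from
this. -/
theorem conjTranspose_mul_sectorMap {κ : Type*} [Fintype κ] (w : Fin D → κ → ℂ) :
    (sectorMap ψ w).conjTranspose * sectorMap ψ w =
      (Matrix.of fun j i => star (ψ j i) : Matrix (Fin D) (Fin D) ℂ).conjTranspose *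
        Matrix.diagonal (fun j => ((∑ x, ‖w j x‖ ^ 2 : ℝ) : ℂ)) *
        (Matrix.of fun j i => star (ψ j i) : Matrix (Fin D) (Fin D) ℂ) := by
  rw [sectorMap, Matrix.conjTranspose_mul, Matrix.mul_assoc, ← Matrix.mul_assoc _ _ (Matrix.of _),
    ← Matrix.mul_assoc]
  congr 2
  ext j j'
  rw [Matrix.mul_apply, Fintype.sum_prod_type, Matrix.diagonal_apply]
  have : ∀ x, ∑ i, (Matrix.of fun (p : κ × Fin D) j => w j p.1 * ψ j p.2).conjTranspose j (x, i) *
      (Matrix.of fun (p : κ × Fin D) j => w j p.1 * ψ j p.2) (x, i) j' =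
      star (w j x) * w j' x * if j = j' then 1 else 0 := by
    intro x
    rw [← sum_star_mul_basis ψ j j', Finset.mul_sum]
    refine Finset.sum_congr rfl fun i _ => ?_
    simp only [Matrix.conjTranspose_apply, Matrix.of_apply, star_mul']
    ring
  rw [Finset.sum_congr rfl fun x _ => this x]
  split_ifs with h
  · subst h
    push_cast
    refine Finset.sum_congr rfl fun x _ => ?_
    rw [mul_one, RCLike.star_def, Complex.conj_mul']
  · simp

theorem conjTranspose_mul_basisMatrix :
    (Matrix.of fun j i => star (ψ j i) : Matrix (Fin D) (Fin D) ℂ).conjTranspose *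
      (Matrix.of fun j i => star (ψ j i) : Matrix (Fin D) (Fin D) ℂ) = 1 := by
  ext i i'
  rw [Matrix.mul_apply, Matrix.one_apply, ← sum_basis_mul_star ψ]
  simp

theorem sectorMap_isometry {κ : Type*} [Fintype κ] {w : Fin D → κ → ℂ}
    (hw : ∀ j, ∑ x, ‖w j x‖ ^ 2 = 1) : (sectorMap ψ w).conjTranspose * sectorMap ψ w = 1 := by
  rw [conjTranspose_mul_sectorMap]
  simp only [hw, Complex.ofReal_one, Matrix.diagonal_one, Matrix.mul_one]
  exact conjTranspose_mul_basisMatrix ψ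

theorem posSemidef_sub_sectorMap {κ : Type*} [Fintype κ] {w : Fin D → κ → ℂ} {c : ℝ}
    (hw : ∀ j, ∑ x, ‖w j x‖ ^ 2 ≤ c) :
    ((c : ℂ) • (1 : Matrix (Fin D) (Fin D) ℂ) -
      (sectorMap ψ w).conjTranspose * sectorMap ψ w).PosSemidef := by
  have h : (c : ℂ) • (1 : Matrix (Fin D) (Fin D) ℂ) -
      (sectorMap ψ w).conjTranspose * sectorMap ψ w =
      (Matrix.of fun j i => star (ψ j i) : Matrix (Fin D) (Fin D) ℂ).conjTranspose *
        Matrix.diagonal (fun j => ((c - ∑ x, ‖w j x‖ ^ 2 : ℝ) : ℂ)) *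
        (Matrix.of fun j i => star (ψ j i) : Matrix (Fin D) (Fin D) ℂ) := by
    have : Matrix.diagonal (fun j => ((c - ∑ x, ‖w j x‖ ^ 2 : ℝ) : ℂ)) =
        (c : ℂ) • (1 : Matrix (Fin D) (Fin D) ℂ) -
          Matrix.diagonal (fun j => ((∑ x, ‖w j x‖ ^ 2 : ℝ) : ℂ)) := by
      rw [← Matrix.diagonal_one, ← Matrix.diagonal_smul, Matrix.diagonal_sub]
      congr 1
      ext j
      simp
    rw [this, conjTranspose_mul_sectorMap, Matrix.mul_sub, Matrix.sub_mul, Matrix.mul_smul,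
      Matrix.smul_mul, Matrix.mul_one, conjTranspose_mul_basisMatrix]
  rw [h]
  refine Matrix.PosSemidef.conjTranspose_mul_mul_same (Matrix.PosSemidef.diagonal fun j => ?_) _
  have := sub_nonneg.2 (hw j)
  simpa using (by exact_mod_cast this : (0 : ℂ) ≤ ((c - ∑ x, ‖w j x‖ ^ 2 : ℝ) : ℂ))

theorem idealIsometry_eq_sectorMap (n m : ℕ) (lam φ : Fin D → ℝ)
    (gar : Fin D → EuclideanSpace ℂ (Bits (Fin m))) :
    idealIsometry n m ψ lam φ gar = sectorMap ψ fun j x => Complex.exp (Complex.I * φ j) *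
      ((if x.1 = encode n ⌊2 ^ n * lam j⌋₊ then (1 : ℂ) else 0) * gar j x.2) := by
  ext p i
  rw [idealIsometry, sectorMap, Matrix.mul_apply, Matrix.sum_apply]
  refine Finset.sum_congr rfl fun j _ => ?_
  simp only [Matrix.smul_apply, Matrix.vecMulVec_apply, Matrix.of_apply, smul_eq_mul]
  ring

theorem kronecker_one_mul_sectorMap {κ : Type*} [Fintype κ] (A : Matrix κ κ ℂ)
    (v : Fin D → κ → ℂ) :
    (A ⊗ₖ (1 : Matrix (Fin D) (Fin D) ℂ)) * sectorMap ψ v =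
      sectorMap ψ fun j => A.mulVec (v j) := by
  rw [sectorMap, sectorMap, ← Matrix.mul_assoc]
  congr 1
  ext p j
  rw [Matrix.mul_apply, Fintype.sum_prod_type]
  simp only [Matrix.kroneckerMap_apply, Matrix.of_apply, Matrix.one_apply, mul_ite, mul_one,
    mul_zero, ite_mul, zero_mul, Finset.sum_ite_eq, Finset.mem_univ, if_true, Matrix.mulVec,
    dotProduct, Finset.sum_mul, mul_assoc]

variable {ψ} in
theorem kronecker_mul_sectorMap {κ : Type*} [Fintype κ] (A : Matrix κ κ ℂ)
    {U : Matrix (Fin D) (Fin D) ℂ} {ω : Fin D → ℂ}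
    (hU : ∀ j, U.mulVec (ψ j).ofLp = ω j • (ψ j).ofLp) (v : Fin D → κ → ℂ) :
    (A ⊗ₖ U) * sectorMap ψ v = sectorMap ψ fun j => ω j • A.mulVec (v j) := by
  rw [sectorMap, sectorMap, ← Matrix.mul_assoc]
  congr 1
  ext p j
  have h := congrFun (hU j) p.2
  rw [Matrix.mulVec, dotProduct] at h
  rw [Matrix.mul_apply, Fintype.sum_prod_type]
  simp only [Matrix.kroneckerMap_apply, Matrix.of_apply, Pi.smul_apply, smul_eq_mul,
    Matrix.mulVec, dotProduct, Finset.sum_mul, Finset.mul_sum] at h ⊢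
  refine Finset.sum_congr rfl fun x _ => ?_
  calc _ = A p.1 x * v j x * ∑ i, U p.2 i * ψ j i := by
        rw [Finset.mul_sum]; exact Finset.sum_congr rfl fun i _ => by ring
    _ = _ := by rw [h]; ring

/-- The action of a gate on the work qubits when the system is in an eigenstate of the queried
unitary with eigenvalue `ω`. -/
noncomputable def Gate.act {Q : Type} [Fintype Q] [DecidableEq Q] (ω : ℂ) :
    Gate Q → (Bits Q → ℂ) → (Bits Q → ℂ)
  | .localUnitary e V, v => (onQubits e V.1).mulVec v
  | .reversible π, v => fun z => v (π.symm z)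
  | .ctrl q, v => fun z => (if z q then ω else 1) * v z
  | .ctrlDagger q, v => fun z => (if z q then star ω else 1) * v z

variable {ψ} in
theorem controlled_mul_sectorMap {Q : Type} [Fintype Q] [DecidableEq Q]
    {U : Matrix (Fin D) (Fin D) ℂ} {ω : Fin D → ℂ}
    (hU : ∀ j, U.mulVec (ψ j).ofLp = ω j • (ψ j).ofLp) (q : Q) (v : Fin D → Bits Q → ℂ) :
    controlled q U * sectorMap ψ v =
      sectorMap ψ fun j z => (if z q then ω j else 1) * v j z := by
  rw [controlled, Matrix.add_mul, kronecker_mul_sectorMap _ hU, kronecker_one_mul_sectorMap,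
    sectorMap, sectorMap, sectorMap, ← Matrix.add_mul]
  congr 1
  ext p j
  simp only [Matrix.add_apply, Matrix.of_apply, Pi.smul_apply, Matrix.mulVec_diagonal, smul_eq_mul]
  split_ifs <;> ring

variable {ψ} in
theorem Gate.toMatrix_mul_sectorMap {Q : Type} [Fintype Q] [DecidableEq Q]
    {U : Matrix (Fin D) (Fin D) ℂ} {ω : Fin D → ℂ}
    (hU : ∀ j, U.mulVec (ψ j).ofLp = ω j • (ψ j).ofLp)
    (hU' : ∀ j, U.conjTranspose.mulVec (ψ j).ofLp = star (ω j) • (ψ j).ofLp)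
    (g : Gate Q) (v : Fin D → Bits Q → ℂ) :
    g.toMatrix U * sectorMap ψ v = sectorMap ψ fun j => g.act (ω j) (v j) := by
  cases g with
  | localUnitary e V => exact kronecker_one_mul_sectorMap ψ _ v
  | reversible π =>
    rw [Gate.toMatrix, kronecker_one_mul_sectorMap]
    congr 1
    ext j z
    simp only [Gate.act, Matrix.mulVec, dotProduct, Matrix.of_apply, ite_mul, one_mul, zero_mul]
    simp only [← Equiv.symm_apply_eq, Finset.sum_ite_eq, Finset.mem_univ, if_true]
  | ctrl q => exact controlled_mul_sectorMap hU q v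
  | ctrlDagger q => exact controlled_mul_sectorMap hU' q v

/-- The action of a list of gates on the work qubits when the system is in an eigenstate. -/
noncomputable def actList {Q : Type} [Fintype Q] [DecidableEq Q] (ω : ℂ) (gs : List (Gate Q))
    (v : Bits Q → ℂ) : Bits Q → ℂ :=
  gs.foldl (fun v g => g.act ω v) v

theorem actList_append {Q : Type} [Fintype Q] [DecidableEq Q] (ω : ℂ) (gs hs : List (Gate Q))
    (v : Bits Q → ℂ) : actList ω (gs ++ hs) v = actList ω hs (actList ω gs v) :=
  List.foldl_append

variable {ψ} in
theorem gatesMatrix_mul_sectorMap {Q : Type} [Fintype Q] [DecidableEq Q]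
    {U : Matrix (Fin D) (Fin D) ℂ} {ω : Fin D → ℂ}
    (hU : ∀ j, U.mulVec (ψ j).ofLp = ω j • (ψ j).ofLp)
    (hU' : ∀ j, U.conjTranspose.mulVec (ψ j).ofLp = star (ω j) • (ψ j).ofLp)
    (gs : List (Gate Q)) (v : Fin D → Bits Q → ℂ) :
    gatesMatrix U gs * sectorMap ψ v = sectorMap ψ fun j => actList (ω j) gs (v j) := by
  induction gs generalizing v with
  | nil => rw [gatesMatrix, Matrix.one_mul]; rfl
  | cons g gs ih =>
    rw [gatesMatrix, Matrix.mul_assoc, Gate.toMatrix_mul_sectorMap hU hU', ih]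
    rfl

/-- The state `|0…0⟩`. -/
noncomputable def zeroState (Q : Type*) [DecidableEq (Bits Q)] : Bits Q → ℂ :=
  fun z => if z = fun _ => false then 1 else 0

-- By completeness of ψ, appending |0…0⟩ is itself a sector map with constant work vector; every
-- gate then preserves this form.
variable {ψ} in
theorem EstimationCircuit.run_eq_sectorMap {n : ℕ} (C : EstimationCircuit n)
    {U : Matrix (Fin D) (Fin D) ℂ} {ω : Fin D → ℂ}
    (hU : ∀ j, U.mulVec (ψ j).ofLp = ω j • (ψ j).ofLp)
    (hU' : ∀ j, U.conjTranspose.mulVec (ψ j).ofLp = star (ω j) • (ψ j).ofLp) :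
    C.run U = sectorMap ψ fun j => actList (ω j) C.gates (zeroState _) := by
  rw [← gatesMatrix_mul_sectorMap hU hU', EstimationCircuit.run]
  congr 1
  ext p i
  simp only [sectorMap, Matrix.mul_apply, Matrix.of_apply, mul_assoc, zeroState]
  rw [← Finset.mul_sum, sum_basis_mul_star ψ, mul_ite, mul_one, mul_zero, ← ite_and]
  simp only [and_comm]

theorem spectralSum_mulVec (c : Fin D → ℂ) (j : Fin D) :
    (∑ j, c j • Matrix.vecMulVec (fun i => ψ j i) (fun i => star (ψ j i))).mulVec (ψ j).ofLp =
      c j • (ψ j).ofLp := by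
  ext i
  simp only [Matrix.mulVec, dotProduct, Matrix.sum_apply, Matrix.smul_apply, Matrix.vecMulVec_apply,
    smul_eq_mul, Finset.sum_mul, Pi.smul_apply]
  rw [Finset.sum_comm]
  have : ∀ j', ∑ x, c j' * (ψ j' i * star (ψ j' x)) * ψ j x =
      c j' * ψ j' i * if j' = j then 1 else 0 := by
    intro j'
    rw [← sum_star_mul_basis ψ j' j, Finset.mul_sum]
    exact Finset.sum_congr rfl fun x _ => by ring
  rw [Finset.sum_congr rfl fun j' _ => this j']
  simp

theorem conjTranspose_spectralSum (c : Fin D → ℂ) :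
    (∑ j, c j • Matrix.vecMulVec (fun i => ψ j i) (fun i => star (ψ j i))).conjTranspose =
      ∑ j, star (c j) • Matrix.vecMulVec (fun i => ψ j i) (fun i => star (ψ j i)) := by
  ext i i'
  simp only [Matrix.conjTranspose_apply, Matrix.sum_apply, Matrix.smul_apply,
    Matrix.vecMulVec_apply, smul_eq_mul, star_sum, star_mul', star_star]
  exact Finset.sum_congr rfl fun x _ => by ring

end Sectors

/-! ### The state produced by the circuit -/

/-- Without ancillas the partial trace has a single summand, so it merely relabels the basis. -/
theorem EstimationCircuit.channel_eq_conjChannel {n m : ℕ} {d : Type} [DecidableEq d] [Fintype d]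
    (gs : List (Gate (Fin n ⊕ Fin m ⊕ Fin 0))) (U : Matrix d d ℂ) :
    EstimationCircuit.channel ⟨m, 0, gs⟩ U = conjChannel (Matrix.of fun (p : Out n m d) i =>
      EstimationCircuit.run ⟨m, 0, gs⟩ U (Sum.elim p.1.1 (Sum.elim p.1.2 fun _ => false), p.2) i) := by
  ext X p q
  simp only [EstimationCircuit.channel, discard, conjChannel, LinearMap.comp_apply, LinearMap.coe_mk,
    AddHom.coe_mk, Matrix.of_apply]
  rw [Fintype.sum_subsingleton _ (fun _ => false)]
  simp only [Matrix.mul_apply, Matrix.of_apply, Matrix.conjTranspose_apply]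

/-- Row z is supported on the strings agreeing with z off the range of e, and these are exactly z
with the qubits of e overwritten by some w. -/
theorem onQubits_mulVec {Q : Type*} [Fintype Q] [DecidableEq Q] {k : ℕ} (e : Fin k ↪ Q)
    (V : Matrix (Bits (Fin k)) (Bits (Fin k)) ℂ) (v : Bits Q → ℂ) (z : Bits Q) :
    (onQubits e V).mulVec v z = ∑ w, V (z ∘ e) w * v (Function.extend e w z) := by
  classical
  rw [Matrix.mulVec, dotProduct]
  simp only [onQubits, Matrix.of_apply, ite_mul, zero_mul]
  rw [← Finset.sum_filter]
  refine Finset.sum_bij' (fun y _ => y ∘ e) (fun w _ => Function.extend e w z) (by simp)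
    (fun w _ => ?_) (fun y hy => ?_) (fun w _ => ?_) (fun y hy => ?_)
  · simp only [Finset.mem_filter, Finset.mem_univ, true_and]
    intro q hq
    rw [Function.extend_apply' _ _ _ (by simpa using hq)]
  · simp only [Finset.mem_filter, Finset.mem_univ, true_and] at hy
    ext q
    by_cases hq : q ∈ Set.range e
    · obtain ⟨i, rfl⟩ := hq
      rw [e.injective.extend_apply]
      rfl
    · rw [Function.extend_apply' _ _ _ (by simpa using hq), hy q hq]
  · ext i
    exact e.injective.extend_apply _ _ _
  · simp only [Finset.mem_filter, Finset.mem_univ, true_and] at hy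
    congr 2
    ext q
    by_cases hq : q ∈ Set.range e
    · obtain ⟨i, rfl⟩ := hq
      rw [e.injective.extend_apply]
      rfl
    · rw [Function.extend_apply' _ _ _ (by simpa using hq), hy q hq]

section Registers

variable (n M b : ℕ)

/-- The state with output register `|0…0⟩` and estimate registers in the states `f l`. -/
noncomputable def productState (f : Fin M → Bits (Fin b) → ℂ) :
    Bits (Fin n ⊕ Fin (M * b) ⊕ Fin 0) → ℂ :=
  fun z => (if (fun i => z (Sum.inl i)) = fun _ => false then 1 else 0) *
    ∏ l, f l (z ∘ estimateQubit n M b l)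

variable {n M b}

theorem estimateQubit_inj {l l' : Fin M} {i i' : Fin b}
    (h : estimateQubit n M b l i = estimateQubit n M b l' i') : l = l' ∧ i = i' := by
  have h' := finProdFinEquiv.injective (Sum.inl_injective (Sum.inr_injective h))
  exact ⟨congrArg Prod.fst h', congrArg Prod.snd h'⟩

theorem estimateQubit_surj (q : Fin (M * b)) : ∃ l i, Sum.inr (Sum.inl q) = estimateQubit n M b l i :=
  ⟨(finProdFinEquiv.symm q).1, (finProdFinEquiv.symm q).2, by
    change _ = Sum.inr (Sum.inl (finProdFinEquiv (finProdFinEquiv.symm q)))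
    rw [Equiv.apply_symm_apply]⟩

theorem productState_update (f : Fin M → Bits (Fin b) → ℂ) (l : Fin M) (g : Bits (Fin b) → ℂ)
    (z : Bits (Fin n ⊕ Fin (M * b) ⊕ Fin 0)) :
    productState n M b (Function.update f l g) z =
      (if (fun i => z (Sum.inl i)) = fun _ => false then 1 else 0) *
        (g (z ∘ estimateQubit n M b l) *
          ∏ l' ∈ Finset.univ.erase l, f l' (z ∘ estimateQubit n M b l')) := by
  rw [productState, ← Finset.mul_prod_erase _ _ (Finset.mem_univ l), Function.update_self]
  congr 2
  refine Finset.prod_congr rfl fun l' hl' => ?_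
  rw [Function.update_of_ne (Finset.ne_of_mem_erase hl')]

/-- Overwriting qubits of register l leaves the output register and the other registers alone, so
only one factor of the product changes. -/
theorem localUnitary_act_productState {k : ℕ} (e : Fin k ↪ Fin b) (l : Fin M)
    (V : Matrix (Bits (Fin k)) (Bits (Fin k)) ℂ) (f : Fin M → Bits (Fin b) → ℂ) :
    (onQubits (e.trans (estimateQubit n M b l)) V).mulVec (productState n M b f) =
      productState n M b (Function.update f l ((onQubits e V).mulVec (f l))) := by
  ext z
  rw [productState_update, onQubits_mulVec, onQubits_mulVec, Finset.sum_mul, Finset.mul_sum]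
  refine Finset.sum_congr rfl fun w _ => ?_
  set z' := Function.extend (e.trans (estimateQubit n M b l)) w z with hz'
  have h1 : (fun i => z' (Sum.inl i)) = fun i => z (Sum.inl i) := by
    ext i
    rw [hz', Function.extend_apply']
    rintro ⟨j, hj⟩
    exact absurd hj (by simp [estimateQubit])
  have h2 : ∀ l' ≠ l, z' ∘ estimateQubit n M b l' = z ∘ estimateQubit n M b l' := by
    intro l' hl'
    ext i
    rw [hz', Function.comp_apply, Function.extend_apply']
    · rfl
    rintro ⟨j, hj⟩
    exact hl' (estimateQubit_inj hj).1.symm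
  have h3 : z' ∘ estimateQubit n M b l = Function.extend e w (z ∘ estimateQubit n M b l) := by
    ext i
    by_cases hi : i ∈ Set.range e
    · obtain ⟨j, rfl⟩ := hi
      rw [e.injective.extend_apply]
      exact (e.trans (estimateQubit n M b l)).injective.extend_apply _ _ j
    · rw [Function.extend_apply' _ _ _ (by simpa using hi), hz', Function.comp_apply,
        Function.extend_apply']
      · rfl
      rintro ⟨j, hj⟩
      exact hi ⟨j, (estimateQubit_inj hj).2⟩
  rw [productState, h1, ← Finset.mul_prod_erase _ _ (Finset.mem_univ l), h3,
    Finset.prod_congr rfl fun l' hl' => by rw [h2 l' (Finset.ne_of_mem_erase hl')]]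
  have : z ∘ (e.trans (estimateQubit n M b l)) = (z ∘ estimateQubit n M b l) ∘ e := rfl
  rw [this]
  ring

theorem onQubits_refl (V : Matrix (Bits (Fin b)) (Bits (Fin b)) ℂ) :
    onQubits (Function.Embedding.refl _) V = V := by
  ext x y
  simp only [onQubits, Matrix.of_apply]
  rw [if_pos]
  · rfl
  · intro q hq
    exact absurd ⟨q, rfl⟩ hq

theorem localUnitary_act_productState_register (l : Fin M)
    (V : Matrix (Bits (Fin b)) (Bits (Fin b)) ℂ) (f : Fin M → Bits (Fin b) → ℂ) :
    (onQubits (estimateQubit n M b l) V).mulVec (productState n M b f) =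
      productState n M b (Function.update f l (V.mulVec (f l))) := by
  have := localUnitary_act_productState (n := n) (Function.Embedding.refl _) l V f
  rwa [onQubits_refl] at this

theorem ctrl_act_productState (ω : ℂ) (l : Fin M) (i : Fin b) (f : Fin M → Bits (Fin b) → ℂ) :
    (Gate.ctrl (estimateQubit n M b l i)).act ω (productState n M b f) =
      productState n M b (Function.update f l fun x => (if x i then ω else 1) * f l x) := by
  ext z
  rw [productState_update]
  change _ * productState n M b f z = _
  rw [productState, ← Finset.mul_prod_erase _ _ (Finset.mem_univ l)]
  simp only [Function.comp_apply]
  ring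

/-- Product form over the qubits is what lets the Hadamard gates be followed one at a time. -/
theorem hadamard_onQubits_mulVec (i : Fin b) (e : Fin 1 ↪ Fin b) (he : e 0 = i)
    (g : Fin b → Bool → ℂ) :
    (onQubits e hadamardMatrix).mulVec (fun x : Bits (Fin b) => ∏ j, g j (x j)) =
      fun x => ∏ j, Function.update g i
        (fun c => (g i false + (if c then -1 else 1) * g i true) / (Real.sqrt 2 : ℂ)) j (x j) := by
  ext x
  have hx : ∀ w : Bits (Fin 1), Function.extend e w x = Function.update x i (w 0) := by
    intro w
    ext j
    by_cases hj : j = i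
    · subst hj
      rw [← he, e.injective.extend_apply, Function.update_self]
    · rw [Function.update_of_ne hj, Function.extend_apply']
      rintro ⟨a, rfl⟩
      exact hj (by rw [← he, Subsingleton.elim a 0])
  rw [onQubits_mulVec, ← Finset.mul_prod_erase _ _ (Finset.mem_univ i)]
  have hprod : ∀ w : Bits (Fin 1), ∏ j, g j (Function.extend e w x j) =
      g i (w 0) * ∏ j ∈ Finset.univ.erase i, g j (x j) := by
    intro w
    rw [hx, ← Finset.mul_prod_erase _ _ (Finset.mem_univ i), Function.update_self]
    congr 1
    refine Finset.prod_congr rfl fun j hj => ?_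
    rw [Function.update_of_ne (Finset.ne_of_mem_erase hj)]
  have hprod' : ∏ j ∈ Finset.univ.erase i, Function.update g i
      (fun c => (g i false + (if c then -1 else 1) * g i true) / (Real.sqrt 2 : ℂ)) j (x j) =
      ∏ j ∈ Finset.univ.erase i, g j (x j) :=
    Finset.prod_congr rfl fun j hj => by rw [Function.update_of_ne (Finset.ne_of_mem_erase hj)]
  rw [hprod', Function.update_self]
  rw [← (Equiv.funUnique (Fin 1) Bool).symm.sum_comp, Fintype.sum_bool]
  simp only [hprod, hadamardMatrix, Matrix.of_apply, Equiv.funUnique_symm_apply, uniqueElim_const,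
    Function.comp_apply, he]
  cases x i <;> simp <;> ring

/-- The register after Hadamard gates on the qubits in `s`. -/
noncomputable def partialUniform (b : ℕ) (s : Finset (Fin b)) : Bits (Fin b) → ℂ :=
  fun x => ∏ j, (if j ∈ s then ((Real.sqrt 2 : ℂ))⁻¹ else if x j then 0 else 1)

theorem hadamard_partialUniform (i : Fin b) (e : Fin 1 ↪ Fin b) (he : e 0 = i)
    {s : Finset (Fin b)} (hi : i ∉ s) :
    (onQubits e hadamardMatrix).mulVec (partialUniform b s) = partialUniform b (insert i s) := by
  have h := hadamard_onQubits_mulVec i e he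
    (fun j c => if j ∈ s then ((Real.sqrt 2 : ℂ))⁻¹ else if c then 0 else 1)
  refine h.trans ?_
  ext x
  refine Finset.prod_congr rfl fun j _ => ?_
  by_cases hj : j = i
  · subst hj
    simp [hi]
  · rw [Function.update_of_ne hj]
    simp [hj]

theorem actList_hadamards (ω : ℂ) (l : Fin M) (L : List (Fin b)) (s : Finset (Fin b))
    (hL : L.Nodup) (hs : ∀ i ∈ L, i ∉ s) (f : Fin M → Bits (Fin b) → ℂ)
    (hf : f l = partialUniform b s) :
    actList ω (L.map fun i => Gate.localUnitary
        ⟨fun _ : Fin 1 => estimateQubit n M b l i, fun _ _ _ => Subsingleton.elim _ _⟩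
        ⟨hadamardMatrix, hadamardMatrix_mem⟩) (productState n M b f) =
      productState n M b (Function.update f l (partialUniform b (s ∪ L.toFinset))) := by
  induction L generalizing s f with
  | nil => simp [actList, ← hf]
  | cons i L ih =>
    rw [List.map_cons, actList, List.foldl_cons]
    let e : Fin 1 ↪ Fin b := ⟨fun _ => i, fun _ _ _ => Subsingleton.elim _ _⟩
    have h := localUnitary_act_productState (n := n) e l hadamardMatrix f
    have h' : Gate.act ω (Gate.localUnitary
        ⟨fun _ : Fin 1 => estimateQubit n M b l i, fun _ _ _ => Subsingleton.elim _ _⟩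
        ⟨hadamardMatrix, hadamardMatrix_mem⟩) (productState n M b f) = _ := h
    rw [h', hf, hadamard_partialUniform i e rfl (hs i (by simp))]
    rw [List.nodup_cons] at hL
    refine (ih (insert i s) hL.2 ?_ _ (Function.update_self ..)).trans ?_
    · intro j hj
      rw [Finset.mem_insert, not_or]
      exact ⟨fun h => hL.1 (h ▸ hj), hs j (by simp [hj])⟩
    · rw [Function.update_idem]
      congr 2
      ext j
      simp

theorem actList_replicate_ctrl (ω : ℂ) (l : Fin M) (i : Fin b) (k : ℕ)
    (f : Fin M → Bits (Fin b) → ℂ) :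
    actList ω (List.replicate k (Gate.ctrl (estimateQubit n M b l i))) (productState n M b f) =
      productState n M b (Function.update f l fun x => (if x i then ω else 1) ^ k * f l x) := by
  induction k generalizing f with
  | zero => simp [actList]
  | succ k ih =>
    rw [List.replicate_succ, actList, List.foldl_cons, ctrl_act_productState]
    refine (ih _).trans ?_
    rw [Function.update_idem, Function.update_self]
    congr 2
    ext x
    ring

theorem actList_controlledPowers (ω : ℂ) (l : Fin M) (L : List (Fin b))
    (f : Fin M → Bits (Fin b) → ℂ) :
    actList ω (L.flatMap fun i : Fin b =>
        List.replicate (2 ^ i.val) (Gate.ctrl (estimateQubit n M b l i))) (productState n M b f) =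
      productState n M b (Function.update f l fun x =>
        (L.map fun i => (if x i then ω else 1) ^ 2 ^ i.val).prod * f l x) := by
  induction L generalizing f with
  | nil => simp [actList]
  | cons i L ih =>
    rw [List.flatMap_cons, actList_append, actList_replicate_ctrl, ih, Function.update_idem,
      Function.update_self]
    congr 2
    ext x
    rw [List.map_cons, List.prod_cons]
    ring

theorem ofBits_eq_sum {b : ℕ} (x : Bits (Fin b)) :
    Nat.ofBits x = ∑ i : Fin b, if x i then 2 ^ i.val else 0 := by
  induction b with
  | zero => simp
  | succ b ih =>
    rw [Nat.ofBits_succ, ih, Fin.sum_univ_succ, Finset.mul_sum, add_comm]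
    congr 1
    · cases x 0 <;> simp
    · refine Finset.sum_congr rfl fun i _ => ?_
      simp only [Function.comp_apply, Fin.val_succ, pow_succ']
      split_ifs <;> rfl

theorem prod_controlledPowers (ω : ℂ) (x : Bits (Fin b)) :
    ((List.finRange b).map fun i => (if x i then ω else 1) ^ 2 ^ i.val).prod =
      ω ^ Nat.ofBits x := by
  rw [ofBits_eq_sum, ← Finset.prod_pow_eq_pow_sum, ← List.prod_ofFn, List.ofFn_eq_map]
  congr 2
  ext i
  split_ifs <;> simp

/-- The final amplitudes of an estimate register. -/
noncomputable def registerState (b : ℕ) (s : ℝ) (ω : ℂ) : Bits (Fin b) → ℂ :=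
  (inverseQFTMatrix b).mulVec ((shiftMatrix b s).mulVec
    fun x => ω ^ Nat.ofBits x * ((Real.sqrt 2 : ℂ))⁻¹ ^ b)

theorem actList_estimateGates (s : ℝ) (ω : ℂ) (l : Fin M) (f : Fin M → Bits (Fin b) → ℂ)
    (hf : f l = partialUniform b ∅) :
    actList ω (estimateGates n M b s l) (productState n M b f) =
      productState n M b (Function.update f l (registerState b s ω)) := by
  rw [estimateGates, actList_append, actList_append,
    actList_hadamards ω l _ ∅ (List.nodup_finRange b) (by simp) f hf, actList_controlledPowers]
  simp only [actList, List.foldl_cons, List.foldl_nil, Gate.act,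
    localUnitary_act_productState_register, Function.update_idem, Function.update_self]
  congr 2
  rw [registerState]
  congr 2
  ext x
  rw [prod_controlledPowers]
  simp [partialUniform]

theorem actList_flatMap_estimateGates (s : ℝ) (ω : ℂ) (L : List (Fin M)) (hL : L.Nodup)
    (f : Fin M → Bits (Fin b) → ℂ) (hf : ∀ l ∈ L, f l = partialUniform b ∅) :
    actList ω (L.flatMap (estimateGates n M b s)) (productState n M b f) =
      productState n M b (fun l => if l ∈ L then registerState b s ω else f l) := by
  induction L generalizing f with
  | nil => simp [actList]
  | cons l L ih =>
    rw [List.nodup_cons] at hL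
    rw [List.flatMap_cons, actList_append, actList_estimateGates s ω l f (hf l (by simp)),
      ih hL.2]
    · congr 1
      ext l' : 1
      by_cases h : l' = l
      · subst h
        simp
      · simp [h]
    · intro l' hl'
      rw [Function.update_of_ne (fun h : l' = l => hL.1 (h ▸ hl')), hf l' (by simp [hl'])]

theorem zeroState_eq_productState :
    zeroState (Fin n ⊕ Fin (M * b) ⊕ Fin 0) = productState n M b (fun _ => partialUniform b ∅) := by
  ext z
  have h : ∀ x : Bits (Fin b), partialUniform b ∅ x = if x = fun _ => false then 1 else 0 := by
    intro x
    rw [partialUniform]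
    simp only [Finset.notMem_empty, if_false]
    split_ifs with hx
    · simp [hx]
    · obtain ⟨i, hi⟩ := Function.ne_iff.1 hx
      exact Finset.prod_eq_zero (Finset.mem_univ i) (by simpa using hi)
  simp only [productState, h, zeroState]
  rw [Finset.prod_ite_zero, Finset.prod_const_one, mul_ite, mul_one, mul_zero, ← ite_and]
  congr 1
  refine propext ⟨fun h => ?_, fun h => ?_⟩
  · subst h
    exact ⟨fun _ _ => rfl, rfl⟩
  · ext (i | q | q)
    · exact congrFun h.2 i
    · obtain ⟨l, i, hq⟩ := estimateQubit_surj (n := n) q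
      rw [hq]
      exact congrFun (h.1 l (Finset.mem_univ l)) i
    · exact q.elim0

/-- The final amplitudes of the work qubits. -/
theorem actList_standardPhaseEstimation (r : ℕ) (s : ℝ) (ω : ℂ) (o : Bits (Fin n))
    (g : Bits (Fin (M * b))) :
    actList ω ((List.finRange M).flatMap (estimateGates n M b s) ++
        [Gate.reversible (copyMedian n M b r)]) (zeroState _)
      (Sum.elim o (Sum.elim g fun _ => false)) =
      (if o = encode n (median fun l => Nat.ofBits (fun i => g (finProdFinEquiv (l, i))) / 2 ^ r)
        then 1 else 0) *
      ∏ l, registerState b s ω fun i => g (finProdFinEquiv (l, i)) := by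
  rw [zeroState_eq_productState, actList_append,
    actList_flatMap_estimateGates _ _ _ (List.nodup_finRange M) _ (fun _ _ => rfl)]
  simp only [List.mem_finRange, if_true]
  -- A permutation gate evaluates the state at the inverse image; `copyMedian` is an involution, so
  -- it is its own inverse.
  change productState n M b (fun _ => registerState b s ω)
    (copyMedian n M b r (Sum.elim o (Sum.elim g fun _ => false))) = _
  rw [productState]
  congr 2
  change ((fun i => xor (o i) (encode n (median fun l =>
    Nat.ofBits (fun i => g (finProdFinEquiv (l, i))) / 2 ^ r) i)) = fun _ => false) = _
  refine propext ⟨fun h => ?_, fun h => ?_⟩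
  · ext i
    simpa using congrFun h i
  · ext i
    simp [h]

end Registers

/-! ### Estimates for sinc and for the parameters -/

-- This is sinc²(πf) + sinc²(π(1 - f)) ≥ 8/π² with denominators cleared, on the half of [0, 1] to
-- which the symmetry f ↦ 1 - f reduces it.
open Real in
theorem eight_mul_le_sin_sq {f : ℝ} (h0 : 0 ≤ f) (h1 : f ≤ 1 / 2) :
    8 * (f ^ 2 * (1 - f) ^ 2) ≤ sin (π * f) ^ 2 * ((1 - f) ^ 2 + f ^ 2) := by
  have hpi := pi_gt_d2
  have hpi' := pi_lt_d4
  have hsq : 9.85 ≤ π ^ 2 := by nlinarith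
  have hsq' : π ^ 2 ≤ 9.88 := by nlinarith
  rcases h0.eq_or_lt with rfl | h0
  · simp
  -- Equality holds at f = 1/2, so a Taylor bound at 0 serves only small f; the rest uses the cosine
  -- expansion about 1/2.
  rcases le_total f 0.2 with hf | hf
  · have hs := sin_gt_sub_cube (x := π * f) (by positivity)
    -- 2.47 = 9.88 / 4 exceeds π²/6 with room to spare.
    have hs' : π * f * (1 - 2.47 * f ^ 2) ≤ sin (π * f) := by
      have : π * f * (1 - 2.47 * f ^ 2) ≤ π * f - (π * f) ^ 3 / 6 := by
        have h3 : 0 ≤ π * f * f ^ 2 := by positivity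
        nlinarith
      linarith
    have hnn : 0 ≤ 1 - 2.47 * f ^ 2 := by nlinarith
    have hs2 := pow_le_pow_left₀ (by positivity) hs' 2
    have hpoly : 8 * (1 - f) ^ 2 ≤ 9.85 * (1 - 4.94 * f ^ 2) * ((1 - f) ^ 2 + f ^ 2) := by
      have : 0 ≤ (0.2 - f) * f := mul_nonneg (by linarith) h0.le
      nlinarith [mul_nonneg this h0.le, mul_nonneg this this, mul_nonneg (mul_nonneg this h0.le) h0.le]
    have hmid : 9.85 * (1 - 4.94 * f ^ 2) ≤ π ^ 2 * (1 - 2.47 * f ^ 2) ^ 2 := by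
      have h4 : 1 - 4.94 * f ^ 2 ≤ (1 - 2.47 * f ^ 2) ^ 2 := by nlinarith [sq_nonneg (f ^ 2)]
      have h5 : 0 ≤ 1 - 4.94 * f ^ 2 := by nlinarith
      exact mul_le_mul hsq h4 h5 (by positivity)
    have hq : 0 ≤ (1 - f) ^ 2 + f ^ 2 := by positivity
    calc 8 * (f ^ 2 * (1 - f) ^ 2) = f ^ 2 * (8 * (1 - f) ^ 2) := by ring
      _ ≤ f ^ 2 * (π ^ 2 * (1 - 2.47 * f ^ 2) ^ 2 * ((1 - f) ^ 2 + f ^ 2)) :=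
        mul_le_mul_of_nonneg_left (hpoly.trans (mul_le_mul_of_nonneg_right hmid hq)) (sq_nonneg f)
      _ = (π * f * (1 - 2.47 * f ^ 2)) ^ 2 * ((1 - f) ^ 2 + f ^ 2) := by ring
      _ ≤ _ := mul_le_mul_of_nonneg_right hs2 hq
  · obtain ⟨u, rfl⟩ : ∃ u, f = 1 / 2 - u := ⟨1 / 2 - f, by ring⟩
    have hu0 : 0 ≤ u := by linarith
    have hu1 : u ≤ 0.3 := by linarith
    have hU : u ^ 2 ≤ 0.09 := by nlinarith
    have hsin : sin (π * (1 / 2 - u)) = cos (π * u) := by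
      rw [← sin_pi_div_two_sub]
      congr 1
      ring
    -- 4.94 = 9.88 / 2 bounds π²/2.
    have hc : 1 - 4.94 * u ^ 2 ≤ cos (π * u) := by
      have := one_sub_sq_div_two_le_cos (x := π * u)
      nlinarith [sq_nonneg u]
    have hc2 := pow_le_pow_left₀ (by nlinarith) hc 2
    rw [hsin]
    refine le_trans ?_ (mul_le_mul_of_nonneg_right hc2 (by positivity))
    have hU0 := sq_nonneg u
    have : 0 ≤ u ^ 2 * (1.06 - 3.37 * u ^ 2) := mul_nonneg hU0 (by linarith)
    nlinarith [pow_nonneg hU0 3]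

open Real in
theorem sinc_sq_mul_sq (f : ℝ) : sinc (π * f) ^ 2 * (π ^ 2 * f ^ 2) = sin (π * f) ^ 2 := by
  rcases eq_or_ne f 0 with rfl | h
  · simp
  · have hpi := pi_ne_zero
    rw [sinc_of_ne_zero (by positivity)]
    field_simp

open Real in
theorem sinc_sq_add_sinc_sq {f : ℝ} (h0 : 0 ≤ f) (h1 : f ≤ 1) :
    8 / π ^ 2 ≤ sinc (π * f) ^ 2 + sinc (π * (1 - f)) ^ 2 := by
  have hpi := pi_gt_d2
  have hone : 8 / π ^ 2 ≤ 1 := by rw [div_le_one (by positivity)]; nlinarith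
  rcases h0.eq_or_lt with rfl | h0
  · simp; linarith [sq_nonneg (sinc π)]
  rcases h1.eq_or_lt with rfl | h1
  · simp; linarith [sq_nonneg (sinc π)]
  have key : 8 * (f ^ 2 * (1 - f) ^ 2) ≤ sin (π * f) ^ 2 * ((1 - f) ^ 2 + f ^ 2) := by
    rcases le_total f (1 / 2) with h | h
    · exact eight_mul_le_sin_sq h0.le h
    · have := eight_mul_le_sin_sq (f := 1 - f) (by linarith) (by linarith)
      rw [show π * (1 - f) = π - π * f by ring, sin_pi_sub] at this
      linarith
  have e1 := sinc_sq_mul_sq f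
  have e2 := sinc_sq_mul_sq (1 - f)
  rw [show sin (π * (1 - f)) = sin (π * f) by rw [mul_sub, mul_one, sin_pi_sub]] at e2
  rw [div_le_iff₀ (by positivity)]
  have h1f : 0 < 1 - f := by linarith
  have hpos : 0 < f ^ 2 * (1 - f) ^ 2 := by positivity
  refine le_of_mul_le_mul_right ?_ hpos
  refine key.trans_eq ?_
  linear_combination (-(1 - f) ^ 2) * e1 - f ^ 2 * e2

-- Since sine is concave on [0, π], its graph lies above the chord from 0 to πτ; hence sinc² on |y|
-- ≤ τ is at least its value at τ.
open Real in
theorem gam_le_sinc_sq {y τ : ℝ} (h0 : 0 < τ) (h1 : τ ≤ 1) (hy : |y| ≤ τ) :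
    gam τ ≤ sinc (π * y) ^ 2 := by
  have hpi := pi_pos
  have habs : sinc (π * y) = sinc (π * |y|) := by
    rcases abs_cases y with ⟨h, _⟩ | ⟨h, _⟩ <;> rw [h]
    rw [mul_neg, sinc_neg]
  rw [habs]
  set z := |y|
  have hz : 0 ≤ z := abs_nonneg y
  have hsin : 0 ≤ sin (π * τ) := sin_nonneg_of_nonneg_of_le_pi (by positivity) (by nlinarith)
  rcases hz.eq_or_lt with h | h
  · rw [← h, mul_zero, sinc_zero, one_pow, gam, div_le_one (by positivity), ← mul_pow]
    exact pow_le_pow_left₀ hsin (sin_le (by positivity)) 2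
  · have hconc := strictConcaveOn_sin_Icc.concaveOn.2 (Set.left_mem_Icc.2 hpi.le)
      (show π * τ ∈ Set.Icc 0 π from ⟨by positivity, by nlinarith⟩)
      (show 0 ≤ 1 - z / τ by rw [sub_nonneg, div_le_one h0]; exact hy)
      (show 0 ≤ z / τ by positivity) (by ring)
    simp only [smul_eq_mul, mul_zero, sin_zero, zero_add] at hconc
    rw [show z / τ * (π * τ) = π * z by field_simp] at hconc
    have h2 := pow_le_pow_left₀ (by positivity) hconc 2
    have e := sinc_sq_mul_sq z
    rw [← e] at h2
    rw [gam, div_le_iff₀ (by positivity)]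
    have hz2 : 0 < z ^ 2 := by positivity
    refine le_of_mul_le_mul_right ?_ hz2
    rw [mul_pow, div_pow, div_mul_eq_mul_div, div_le_iff₀ (by positivity)] at h2
    linarith

open Real in
theorem gam_quarter : gam (1 / 4) = 8 / π ^ 2 := by
  rw [gam, show π * (1 / 4) = π / 4 by ring, sin_pi_div_four, div_pow, sq_sqrt (by norm_num)]
  field_simp
  norm_num

open Real in
theorem eight_div_pi_sq_le_gam {τ : ℝ} (h0 : 0 < τ) (h1 : τ ≤ 1 / 4) : 8 / π ^ 2 ≤ gam τ := by
  have h := gam_le_sinc_sq (y := τ) (τ := 1 / 4) (by norm_num) (by norm_num)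
    (by rwa [abs_of_pos h0])
  rw [gam_quarter] at h
  refine h.trans_eq ?_
  have hpi := pi_pos
  rw [gam, ← sinc_sq_mul_sq, mul_div_cancel_right₀ _ (by positivity)]

open Real in
theorem gap_pos {α : ℝ} (h1 : α < 1) : 0 < gap α := by
  have hpi := pi_lt_d2
  have hpi0 := pi_pos
  have h8 : 0 < 8 / π ^ 2 - 1 / 2 := by
    rw [sub_pos, div_lt_div_iff₀ (by norm_num) (by positivity)]
    nlinarith
  rw [gap]
  split_ifs with h
  · exact h8
  · rw [not_le] at h
    have := eight_div_pi_sq_le_gam (τ := (1 - α) / 2) (by linarith) (by linarith)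
    linarith

-- Strictness keeps 1/2 - η positive in `chernoff_majority`.
open Real in
theorem gap_lt_half {α : ℝ} (h1 : α < 1) : gap α < 1 / 2 := by
  have hpi := pi_gt_d2
  rw [gap]
  split_ifs with h
  · have : 8 / π ^ 2 < 1 := by rw [div_lt_one (by positivity)]; nlinarith
    rw [etaZero]
    linarith
  · rw [not_le] at h
    have : gam ((1 - α) / 2) < 1 := by
      have h2 : 0 < π * ((1 - α) / 2) := mul_pos pi_pos (by linarith)
      rw [gam, ← mul_pow, div_lt_one (by positivity)]
      exact pow_lt_pow_left₀ (sin_lt h2)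
        (sin_nonneg_of_nonneg_of_le_pi h2.le (by nlinarith)) two_ne_zero
    linarith

theorem extraBits_of_half_lt {α : ℝ} (h : 1 / 2 < α) : extraBits α = 0 := by
  rw [extraBits, Nat.ceil_eq_zero]
  exact Real.logb_nonpos (by norm_num) (by positivity) (by
    rw [div_le_one (by positivity)]; linarith)

/-- The ceiling makes r the least exponent with 2^r ≥ 1/(2α). After magnification by 2^r the
forbidden part of a bin has length at least 1/2. -/
theorem two_pow_extraBits_mul {α : ℝ} (h0 : 0 < α) (h : α ≤ 1 / 2) :
    1 / 2 ≤ 2 ^ extraBits α * α ∧ 2 ^ extraBits α * α < 1 := by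
  have hL : 0 ≤ Real.logb 2 (1 / (2 * α)) :=
    Real.logb_nonneg (by norm_num) (by rw [le_div_iff₀ (by positivity)]; linarith)
  have h1 := Nat.le_ceil (Real.logb 2 (1 / (2 * α)))
  have h2 := Nat.ceil_lt_add_one hL
  rw [Real.logb_le_iff_le_rpow (by norm_num) (by positivity), Real.rpow_natCast,
    div_le_iff₀ (by positivity)] at h1
  rw [← sub_lt_iff_lt_add, Real.lt_logb_iff_rpow_lt (by norm_num) (by positivity),
    Real.rpow_sub (by norm_num), Real.rpow_natCast, Real.rpow_one,
    lt_div_iff₀ (by positivity)] at h2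
  exact ⟨by rw [extraBits]; linarith, by rw [extraBits]; linarith⟩

/-! ### Outcome distribution of one register -/

section Register

theorem sum_norm_sq_mulVec {m : Type*} [Fintype m] [DecidableEq m] {V : Matrix m m ℂ}
    (hV : V ∈ Matrix.unitaryGroup m ℂ) (v : m → ℂ) :
    ∑ x, ‖V.mulVec v x‖ ^ 2 = ∑ x, ‖v x‖ ^ 2 := by
  have h : ∀ v : m → ℂ, ((∑ x, ‖v x‖ ^ 2 : ℝ) : ℂ) = star v ⬝ᵥ v := by
    intro v
    rw [dotProduct]
    push_cast
    exact Finset.sum_congr rfl fun x _ => (Complex.conj_mul' _).symm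
  have h' := Matrix.mem_unitaryGroup_iff'.1 hV
  rw [← Complex.ofReal_inj, h, h, Matrix.star_mulVec, Matrix.dotProduct_mulVec, Matrix.vecMul_vecMul,
    ← Matrix.star_eq_conjTranspose, h', Matrix.vecMul_one]

theorem sum_norm_sq_registerState (b : ℕ) (s : ℝ) {ω : ℂ} (hω : ‖ω‖ = 1) :
    ∑ x, ‖registerState b s ω x‖ ^ 2 = 1 := by
  rw [registerState, sum_norm_sq_mulVec (inverseQFTMatrix_mem b),
    sum_norm_sq_mulVec (shiftMatrix_mem b s)]
  have : ∀ x : Bits (Fin b), ‖ω ^ Nat.ofBits x * ((Real.sqrt 2 : ℂ))⁻¹ ^ b‖ ^ 2 = (2 ^ b : ℝ)⁻¹ := by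
    intro x
    rw [norm_mul, norm_pow, hω, one_pow, one_mul, norm_pow, norm_inv, Complex.norm_real,
      Real.norm_of_nonneg (Real.sqrt_nonneg 2), ← pow_mul, mul_comm b, pow_mul, inv_pow,
      Real.sq_sqrt (by norm_num), inv_pow]
  rw [Finset.sum_congr rfl fun x _ => this x]
  simp

/-- The eigenphase, the shift and the Fourier kernel are all linear in t, so together they form the
t-th power of one root. -/
theorem registerState_eq_geom_sum (b : ℕ) (s lam : ℝ) (x : Bits (Fin b)) :
    registerState b s (Complex.exp (2 * Real.pi * Complex.I * lam)) x =
      (∑ t ∈ Finset.range (2 ^ b), Complex.exp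
        ((2 * Real.pi * ((2 ^ b * lam - s - Nat.ofBits x) / 2 ^ b) : ℝ) * Complex.I) ^ t) / 2 ^ b := by
  have hs : (Real.sqrt (2 ^ b) : ℂ) * Real.sqrt 2 ^ b = 2 ^ b := by
    have h : Real.sqrt (2 ^ b) = Real.sqrt 2 ^ b := by
      rw [Real.sqrt_eq_iff_mul_self_eq (by positivity) (by positivity), ← mul_pow,
        Real.mul_self_sqrt (by norm_num)]
    rw [← Complex.ofReal_pow, ← Complex.ofReal_mul, ← h, Real.mul_self_sqrt (by positivity)]
    norm_num
  have hN : (2 : ℂ) ^ b ≠ 0 := by positivity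
  set w := Complex.exp
        ((2 * Real.pi * ((2 ^ b * lam - s - Nat.ofBits x) / 2 ^ b) : ℝ) * Complex.I) with hw
  have hsum : ∑ k ∈ Finset.range (2 ^ b), w ^ k = ∑ t : Bits (Fin b), w ^ Nat.ofBits t := by
    rw [← Fin.sum_univ_eq_sum_range]
    exact ((ofBits_bijective b).sum_comp (fun k : Fin (2 ^ b) => w ^ (k : ℕ))).symm
  rw [hsum, Finset.sum_div, registerState, Matrix.mulVec, dotProduct]
  refine Finset.sum_congr rfl fun t _ => ?_
  rw [shiftMatrix, Matrix.mulVec_diagonal, inverseQFTMatrix, Matrix.of_apply, hw,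
    ← Complex.exp_nat_mul, ← Complex.exp_nat_mul]
  rw [inv_pow, div_mul_eq_mul_div, ← mul_assoc, ← mul_assoc, ← div_eq_mul_inv, div_div,
    mul_comm (_ ^ b) (Real.sqrt _ : ℂ), hs, ← Complex.exp_add, ← Complex.exp_add]
  congr 2
  push_cast
  field_simp
  ring

-- With θ the distance from x, the geometric sum has modulus |sin πθ| / |sin(πθ/2^b)|, and
-- |sin(πθ/2^b)| ≤ π|θ|/2^b. At θ = 0 all terms are 1 and both sides equal 1.
open Real in
theorem sinc_sq_le_registerState (b : ℕ) (s lam : ℝ) (x : Bits (Fin b)) :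
    sinc (π * (2 ^ b * lam - s - Nat.ofBits x)) ^ 2 ≤
      ‖registerState b s (Complex.exp (2 * π * Complex.I * lam)) x‖ ^ 2 := by
  rw [registerState_eq_geom_sum]
  set θ := 2 ^ b * lam - s - Nat.ofBits x
  set w := Complex.exp ((2 * π * (θ / 2 ^ b) : ℝ) * Complex.I) with hw
  have hN : (0 : ℝ) < 2 ^ b := by positivity
  have hnorm : ∀ y : ℝ, ‖Complex.exp ((2 * y : ℝ) * Complex.I) - 1‖ = 2 * |sin y| := by
    intro y
    rw [mul_comm, Complex.norm_exp_I_mul_ofReal_sub_one, norm_mul, mul_div_cancel_left₀ _ two_ne_zero]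
    simp
  have hw1 : ‖w - 1‖ = 2 * |sin (π * (θ / 2 ^ b))| := by rw [hw, mul_assoc]; exact hnorm _
  have hwN : ‖w ^ 2 ^ b - 1‖ = 2 * |sin (π * θ)| := by
    rw [← hnorm, hw, ← Complex.exp_nat_mul]
    congr 3
    push_cast
    field_simp
  have hgeom := congrArg norm (geom_sum_mul w (2 ^ b))
  rw [norm_mul, hw1, hwN] at hgeom
  rw [norm_div, norm_pow, Complex.norm_two]
  set S := ‖∑ t ∈ Finset.range (2 ^ b), w ^ t‖ with hS
  have hS0 : 0 ≤ S := norm_nonneg _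
  rw [← sq_abs (sinc _)]
  refine pow_le_pow_left₀ (abs_nonneg _) ?_ 2
  rcases eq_or_ne θ 0 with h | h
  · have : w = 1 := by rw [hw, h]; simp
    rw [hS, this, h]
    simp
  · have habs : 0 < π * |θ| := mul_pos pi_pos (abs_pos.2 h)
    rw [sinc_of_ne_zero (mul_ne_zero pi_ne_zero h), abs_div, abs_mul π, abs_of_pos pi_pos,
      div_le_div_iff₀ habs hN]
    have h1 : |sin (π * (θ / 2 ^ b))| ≤ π * |θ| / 2 ^ b := by
      refine abs_sin_le_abs.trans_eq ?_
      rw [abs_mul, abs_div, abs_of_pos pi_pos, abs_of_pos hN, mul_div_assoc]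
    have h2 := mul_le_mul_of_nonneg_left h1 hS0
    rw [← mul_div_assoc S, le_div_iff₀ hN] at h2
    nlinarith

/-- The probability that an estimate register yields `k` after dropping the last `r` bits. -/
noncomputable def hitProb (b r : ℕ) (s : ℝ) (ω : ℂ) (k : ℕ) : ℝ :=
  ∑ x : Bits (Fin b), if Nat.ofBits x / 2 ^ r = k then ‖registerState b s ω x‖ ^ 2 else 0

open Real in
theorem sinc_sq_le_hitProb {b r k X : ℕ} (s lam : ℝ) (hX : X < 2 ^ b) (hk : X / 2 ^ r = k) :
    sinc (π * (2 ^ b * lam - s - X)) ^ 2 ≤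
      hitProb b r s (Complex.exp (2 * π * Complex.I * lam)) k := by
  have hx := Nat.ofBits_testBit X b
  rw [Nat.mod_eq_of_lt hX] at hx
  have h := sinc_sq_le_registerState b s lam (fun i => X.testBit i)
  rw [hx] at h
  refine h.trans ?_
  rw [hitProb]
  refine le_trans ?_ (Finset.single_le_sum
    (f := fun x : Bits (Fin b) => if Nat.ofBits x / 2 ^ r = k then
      ‖registerState b s (Complex.exp (2 * π * Complex.I * lam)) x‖ ^ 2 else 0)
    (fun x _ => by split_ifs <;> positivity) (Finset.mem_univ (fun i : Fin b => X.testBit i)))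
  rw [hx, if_pos hk]

open Real in
theorem sinc_sq_add_le_hitProb {b r k X Y : ℕ} (s lam : ℝ) (hXY : X ≠ Y) (hX : X < 2 ^ b)
    (hkX : X / 2 ^ r = k) (hY : Y < 2 ^ b) (hkY : Y / 2 ^ r = k) :
    sinc (π * (2 ^ b * lam - s - X)) ^ 2 + sinc (π * (2 ^ b * lam - s - Y)) ^ 2 ≤
      hitProb b r s (Complex.exp (2 * π * Complex.I * lam)) k := by
  have hx := Nat.ofBits_testBit X b
  rw [Nat.mod_eq_of_lt hX] at hx
  have hy := Nat.ofBits_testBit Y b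
  rw [Nat.mod_eq_of_lt hY] at hy
  have h := sinc_sq_le_registerState b s lam (fun i => X.testBit i)
  rw [hx] at h
  have h' := sinc_sq_le_registerState b s lam (fun i => Y.testBit i)
  rw [hy] at h'
  refine (add_le_add h h').trans ?_
  rw [hitProb]
  have hne : (fun i : Fin b => X.testBit i) ≠ fun i : Fin b => Y.testBit i := fun hh =>
    hXY (by rw [← hx, hh, hy])
  refine le_trans ?_ (Finset.sum_le_sum_of_subset_of_nonneg
    (Finset.subset_univ {fun i : Fin b => X.testBit i, fun i : Fin b => Y.testBit i})
    (fun x _ _ => by split_ifs <;> positivity))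
  rw [Finset.sum_pair hne, hx, hy, if_pos hkX, if_pos hkY]

open Real in
theorem half_add_gap_le_hitProb (n : ℕ) {α lam : ℝ} (h0 : 0 < α) (_ : α < 1) {k : ℕ}
    (hk : k < 2 ^ n) (hl : k + α < 2 ^ n * lam) (hu : 2 ^ n * lam < k + 1) :
    1 / 2 + gap α ≤ hitProb (n + extraBits α) (extraBits α) ((1 + 2 ^ extraBits α * α) / 2)
      (Complex.exp (2 * π * Complex.I * lam)) k := by
  by_cases hα : α ≤ 1 / 2
  · obtain ⟨ha, ha'⟩ := two_pow_extraBits_mul h0 hα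
    rw [gap, if_pos hα, etaZero, add_sub_cancel]
    set r := extraBits α
    set s := (1 + 2 ^ r * α) / 2 with hs
    set μ := 2 ^ (n + r) * lam - s with hμ
    have hR : (0 : ℝ) < 2 ^ r := by positivity
    -- The allowed interval from 2^r k + 2^r α to 2^r (k + 1), shifted by s, overshoots the first
    -- and last outcomes of the bin by at most (1 - 2^r α)/2 ≤ 1/4.
    have hμl : 2 ^ r * k - 1 / 4 ≤ μ := by
      have := mul_lt_mul_of_pos_left hl hR
      rw [hμ, pow_add, hs]
      linarith
    have hμu : μ ≤ 2 ^ r * k + 2 ^ r - 1 + 1 / 4 := by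
      have := mul_lt_mul_of_pos_left hu hR
      rw [hμ, pow_add, hs]
      linarith
    have hkr : ∀ i < 2 ^ r, (2 ^ r * k + i) < 2 ^ (n + r) ∧ (2 ^ r * k + i) / 2 ^ r = k := by
      intro i hi
      refine ⟨?_, by rw [Nat.mul_add_div (by positivity), Nat.div_eq_of_lt hi, add_zero]⟩
      calc 2 ^ r * k + i < 2 ^ r * (k + 1) := by rw [mul_add, mul_one]; omega
        _ ≤ 2 ^ r * 2 ^ n := Nat.mul_le_mul_left _ hk
        _ = _ := by rw [pow_add, mul_comm]
    have hclose : ∀ i < 2 ^ r, |μ - (2 ^ r * k + i : ℕ)| ≤ 1 / 4 → 8 / π ^ 2 ≤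
        hitProb (n + r) r s (Complex.exp (2 * π * Complex.I * lam)) k := by
      intro i hi h
      rw [← gam_quarter]
      exact (gam_le_sinc_sq (by norm_num) (by norm_num) h).trans
        (sinc_sq_le_hitProb s lam (hkr i hi).1 (hkr i hi).2)
    have hone : 1 ≤ 2 ^ r := Nat.one_le_two_pow
    -- Outside the span of the bin's outcomes, the nearest end outcome alone gives `gam (1 / 4)`,
    -- which is 8/π².
    rcases le_total μ (2 ^ r * k) with hc | hc
    · refine hclose 0 (by positivity) ?_
      push_cast
      rw [abs_le]
      constructor <;> linarith
    rcases le_total (2 ^ r * k + 2 ^ r - 1 : ℝ) μ with hc' | hc'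
    · refine hclose (2 ^ r - 1) (by omega) ?_
      push_cast [hone]
      rw [abs_le]
      constructor <;> linarith
    -- The strict case guarantees that the upper neighbour i + 1 still belongs to the bin.
    rcases hc'.eq_or_lt with hc'' | hc''
    · refine hclose (2 ^ r - 1) (by omega) ?_
      push_cast [hone]
      rw [abs_le]
      constructor <;> linarith
    · set i := ⌊μ - 2 ^ r * k⌋₊ with hi
      have hf1 : (i : ℝ) ≤ μ - 2 ^ r * k := Nat.floor_le (by linarith)
      have hf2 : μ - 2 ^ r * k < i + 1 := Nat.lt_floor_add_one _
      have hi2 : i + 1 < 2 ^ r := by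
        have : (i : ℝ) + 1 < 2 ^ r := by linarith
        exact_mod_cast this
      obtain ⟨a1, a2⟩ := hkr i (by omega)
      obtain ⟨b1, b2⟩ := hkr (i + 1) hi2
      refine le_trans ?_ (sinc_sq_add_le_hitProb s lam (by omega) a1 a2 b1 b2)
      have := sinc_sq_add_sinc_sq (f := μ - (2 ^ r * k + i : ℕ)) (by push_cast; linarith)
        (by push_cast; linarith)
      refine this.trans_eq ?_
      rw [← sinc_neg (π * (1 - _))]
      congr 4
      push_cast
      ring
  -- Here r = 0, the bin has the single outcome k, and the shifted phase is within (1 - α)/2 of it.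
  · have hα' := not_le.1 hα
    rw [gap, if_neg hα, add_sub_cancel, extraBits_of_half_lt hα']
    have hkb : k < 2 ^ (n + 0) := by simpa using hk
    refine le_trans ?_ (sinc_sq_le_hitProb _ lam hkb (by simp))
    refine gam_le_sinc_sq (by linarith) (by linarith) ?_
    rw [abs_le]
    simp only [pow_zero, one_mul, add_zero]
    constructor <;> linarith

end Register

/-! ### Median and Chernoff bound -/

/-- For x < k the entries at most x are disjoint from a strict majority, hence fewer than half. -/
theorem median_eq_of_majority {M : ℕ} {v : Fin M → ℕ} {k : ℕ}
    (h : M < 2 * (Finset.univ.filter fun l => v l = k).card) : median v = k := by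
  have hk : k ∈ {x | M ≤ 2 * (Finset.univ.filter fun l => v l ≤ x).card} := by
    have : (Finset.univ.filter fun l => v l = k).card ≤
        (Finset.univ.filter fun l => v l ≤ k).card :=
      Finset.card_le_card (Finset.monotone_filter_right _ fun l _ hl => hl.le)
    simp only [Set.mem_ofPred_eq]
    omega
  refine le_antisymm (Nat.sInf_le hk) (le_csInf ⟨k, hk⟩ fun x hx => ?_)
  by_contra hlt
  rw [not_le] at hlt
  simp only [Set.mem_ofPred_eq] at hx
  have hdisj : Disjoint (Finset.univ.filter fun l => v l ≤ x)
      (Finset.univ.filter fun l => v l = k) := by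
    rw [Finset.disjoint_filter]
    intro l _ h1 h2
    omega
  have := (Finset.card_union_of_disjoint hdisj).symm.trans_le (Finset.card_le_univ _)
  rw [Fintype.card_fin] at this
  omega

theorem sum_prod_eq_pow {X : Type*} [Fintype X] (M : ℕ) (p : X → ℝ) :
    ∑ g : Fin M → X, ∏ l, p (g l) = (∑ x, p x) ^ M := by
  classical
  rw [← Fintype.piFinset_univ, ← Finset.prod_univ_sum, Finset.prod_const, Finset.card_univ,
    Fintype.card_fin]

/-- Exponential-moment argument: weight each sample by c⁻¹ if good and by c ≥ 1 if not. The product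
of weights is at least 1 without a good majority, and its expectation factorizes over the samples.
-/
theorem chernoff_majority {X : Type*} [Fintype X] (M : ℕ) {p : X → ℝ} (hp : ∀ x, 0 ≤ p x)
    (hp1 : ∑ x, p x = 1) (good : X → Prop) [DecidablePred good] {η : ℝ} (h0 : 0 ≤ η)
    (h1 : η < 1 / 2) (hq : 1 / 2 + η ≤ ∑ x, if good x then p x else 0) :
    ∑ g : Fin M → X, (if 2 * (Finset.univ.filter fun l => good (g l)).card ≤ M
      then ∏ l, p (g l) else 0) ≤ Real.exp (-(2 * η ^ 2 * M)) := by
  obtain ⟨a, ha, ha2⟩ : ∃ a : ℝ, 0 < a ∧ a ^ 2 = 1 / 2 + η :=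
    ⟨√(1 / 2 + η), by positivity, Real.sq_sqrt (by linarith)⟩
  obtain ⟨d, hd, hd2⟩ : ∃ d : ℝ, 0 < d ∧ d ^ 2 = 1 / 2 - η :=
    ⟨√(1 / 2 - η), Real.sqrt_pos.2 (by linarith), Real.sq_sqrt (by linarith)⟩
  have hda : d ≤ a := by
    refine le_of_sq_le_sq ?_ ha.le
    linarith
  -- This c is optimal for success probability exactly 1/2 + η: both contributions equal a d, and 2
  -- a d = √(1 - 4η²) ≤ exp(-2η²).
  set c := a / d with hc
  have hc1 : 1 ≤ c := by rwa [hc, one_le_div hd]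
  have hc0 : 0 < c := by positivity
  have hcc : c⁻¹ ≤ c := (inv_le_one_of_one_le₀ hc1).trans hc1
  have hweight : ∀ g : Fin M → X, (if 2 * (Finset.univ.filter fun l => good (g l)).card ≤ M
      then ∏ l, p (g l) else 0) ≤ ∏ l, ((if good (g l) then c⁻¹ else c) * p (g l)) := by
    intro g
    have hpp : 0 ≤ ∏ l, p (g l) := Finset.prod_nonneg fun l _ => hp _
    rw [Finset.prod_mul_distrib]
    split_ifs with h
    · refine le_mul_of_one_le_left hpp ?_
      rw [Finset.prod_ite, Finset.prod_const, Finset.prod_const, inv_pow, ← div_eq_inv_mul,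
        one_le_div (by positivity)]
      refine pow_le_pow_right₀ hc1 ?_
      have := Finset.card_filter_add_card_filter_not (s := (Finset.univ : Finset (Fin M)))
        (fun l => good (g l))
      rw [Finset.card_univ, Fintype.card_fin] at this
      omega
    · exact mul_nonneg (Finset.prod_nonneg fun l _ => by split_ifs <;> positivity) hpp
  refine (Finset.sum_le_sum fun g _ => hweight g).trans ?_
  rw [sum_prod_eq_pow M fun x => (if good x then c⁻¹ else c) * p x]
  have hsplit : ∑ x, (if good x then c⁻¹ else c) * p x =
      c - (c - c⁻¹) * ∑ x, if good x then p x else 0 := by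
    rw [show c - (c - c⁻¹) * (∑ x, if good x then p x else 0) =
      c * ∑ x, p x - (c - c⁻¹) * ∑ x, if good x then p x else 0 by rw [hp1, mul_one],
      Finset.mul_sum, Finset.mul_sum, ← Finset.sum_sub_distrib]
    refine Finset.sum_congr rfl fun x _ => ?_
    split_ifs <;> ring
  have hbound : ∑ x, (if good x then c⁻¹ else c) * p x ≤ Real.exp (-(2 * η ^ 2)) := by
    calc _ ≤ c - (c - c⁻¹) * (1 / 2 + η) := by
          rw [hsplit]
          have := mul_le_mul_of_nonneg_left hq (sub_nonneg.2 hcc)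
          linarith
      _ = 2 * (a * d) := by
          have e1 : c * (1 / 2 - η) = a * d := by rw [← hd2, hc]; field_simp
          have e2 : c⁻¹ * (1 / 2 + η) = a * d := by rw [← ha2, hc]; field_simp
          linear_combination e1 + e2
      _ ≤ _ := by
          refine le_of_sq_le_sq ?_ (Real.exp_pos _).le
          have h3 := Real.add_one_le_exp (-(4 * η ^ 2))
          have h4 : Real.exp (-(2 * η ^ 2)) ^ 2 = Real.exp (-(4 * η ^ 2)) := by
            rw [← Real.exp_nat_mul]
            congr 1
            push_cast
            ring
          have h5 : (2 * (a * d)) ^ 2 = 1 - 4 * η ^ 2 := by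
            rw [mul_pow, mul_pow, ha2, hd2]
            ring
          rw [h4, h5]
          linarith
  refine (pow_le_pow_left₀ (Finset.sum_nonneg fun x _ => mul_nonneg ?_ (hp x)) hbound M).trans_eq ?_
  · split_ifs <;> positivity
  · rw [← Real.exp_nat_mul]
    congr 1
    ring

theorem exp_repetitions_le {η δ : ℝ} (hη : 0 < η) (hδ : 0 < δ) :
    Real.exp (-(2 * η ^ 2 * repetitions η δ)) ≤ deltaMed δ := by
  have hd : 0 < deltaMed δ := by rw [deltaMed]; positivity
  rw [← Real.le_log_iff_exp_le hd]
  have h := Nat.le_ceil (Real.log (deltaMed δ)⁻¹ / (2 * η ^ 2))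
  rw [div_le_iff₀ (by positivity), Real.log_inv] at h
  rw [repetitions, Real.log_inv]
  linarith

/-! ### Joint register state and choice of garbage -/

/-- The strings on `M` registers of `b` qubits. -/
def splitRegisters (M b : ℕ) : Bits (Fin (M * b)) ≃ (Fin M → Bits (Fin b)) :=
  (Equiv.arrowCongr finProdFinEquiv.symm (Equiv.refl Bool)).trans (Equiv.curry _ _ _)

/-- The joint amplitudes of the estimate registers. -/
noncomputable def jointState (M b : ℕ) (s : ℝ) (ω : ℂ) (g : Bits (Fin (M * b))) : ℂ :=
  ∏ l, registerState b s ω (splitRegisters M b g l)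

theorem norm_sq_jointState (M b : ℕ) (s : ℝ) (ω : ℂ) (g : Bits (Fin (M * b))) :
    ‖jointState M b s ω g‖ ^ 2 = ∏ l, ‖registerState b s ω (splitRegisters M b g l)‖ ^ 2 := by
  rw [jointState, norm_prod, Finset.prod_pow]

theorem sum_norm_sq_jointState (M b : ℕ) (s : ℝ) {ω : ℂ} (hω : ‖ω‖ = 1) :
    ∑ g, ‖jointState M b s ω g‖ ^ 2 = 1 := by
  simp only [norm_sq_jointState]
  rw [(splitRegisters M b).sum_comp (fun g => ∏ l, ‖registerState b s ω (g l)‖ ^ 2),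
    sum_prod_eq_pow M fun x => ‖registerState b s ω x‖ ^ 2, sum_norm_sq_registerState b s hω,
    one_pow]

/-- The median of the estimates held by the registers. -/
noncomputable def medianOf (M b r : ℕ) (g : Bits (Fin (M * b))) : ℕ :=
  median fun l => Nat.ofBits (splitRegisters M b g l) / 2 ^ r

theorem median_failure_le (M b r : ℕ) (s : ℝ) {ω : ℂ} (hω : ‖ω‖ = 1) {k : ℕ} {η : ℝ}
    (h0 : 0 ≤ η) (h1 : η < 1 / 2) (hq : 1 / 2 + η ≤ hitProb b r s ω k) :
    ∑ g, (if medianOf M b r g = k then 0 else ‖jointState M b s ω g‖ ^ 2) ≤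
      Real.exp (-(2 * η ^ 2 * M)) := by
  refine le_trans ?_ (chernoff_majority M (fun x => sq_nonneg ‖registerState b s ω x‖)
    (sum_norm_sq_registerState b s hω) (fun x => Nat.ofBits x / 2 ^ r = k) h0 h1 hq)
  rw [← (splitRegisters M b).sum_comp]
  refine Finset.sum_le_sum fun g _ => ?_
  simp only [norm_sq_jointState]
  have hnn : 0 ≤ ∏ l, ‖registerState b s ω (splitRegisters M b g l)‖ ^ 2 :=
    Finset.prod_nonneg fun l _ => sq_nonneg _
  split_ifs with h h' h'
  · exact hnn
  · exact le_rfl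
  · exact le_rfl
  · exact absurd (median_eq_of_majority (not_le.1 h')) h

theorem sum_norm_sq_graph {O G : Type*} [Fintype O] [DecidableEq O] [Fintype G] (A : G → ℂ)
    (m : G → O) : ∑ x : O × G, ‖(if x.1 = m x.2 then (1 : ℂ) else 0) * A x.2‖ ^ 2 =
      ∑ g, ‖A g‖ ^ 2 := by
  rw [Fintype.sum_prod_type_right]
  refine Finset.sum_congr rfl fun g _ => ?_
  rw [Finset.sum_eq_single (m g) (fun o _ ho => by simp [ho]) (by simp)]
  simp

/-- The witness is A restricted to m g = k and renormalized. The error has two orthogonal parts: the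
discarded mass p and the rescaling of the rest. -/
theorem exists_normalized_projection {O G : Type*} [Fintype O] [DecidableEq O] [Fintype G]
    {A : G → ℂ} (hA : ∑ g, ‖A g‖ ^ 2 = 1) (m : G → O) (k : O) {ε : ℝ}
    (hε : ∑ g, (if m g = k then 0 else ‖A g‖ ^ 2) ≤ ε) (hε1 : ε ≤ 0.64) :
    ∃ gar : EuclideanSpace ℂ G, ‖gar‖ = 1 ∧
      ∑ x : O × G, ‖(if x.1 = m x.2 then (1 : ℂ) else 0) * A x.2 -
        (if x.1 = k then (1 : ℂ) else 0) * gar x.2‖ ^ 2 ≤ 1.5625 * ε := by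
  set p := ∑ g, (if m g = k then 0 else ‖A g‖ ^ 2) with hp
  have hp0 : 0 ≤ p := Finset.sum_nonneg fun g _ => by split_ifs <;> positivity
  have hgood : ∑ g, (if m g = k then ‖A g‖ ^ 2 else 0) = 1 - p := by
    rw [hp, ← hA, ← Finset.sum_sub_distrib]
    exact Finset.sum_congr rfl fun g _ => by split_ifs <;> ring
  obtain ⟨u, hu, hu2⟩ : ∃ u : ℝ, 0 < u ∧ u ^ 2 = 1 - p :=
    ⟨√(1 - p), Real.sqrt_pos.2 (by linarith), Real.sq_sqrt (by linarith)⟩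
  refine ⟨WithLp.toLp 2 fun g => if m g = k then (u : ℂ)⁻¹ * A g else 0, ?_, ?_⟩
  · rw [← sq_eq_sq₀ (norm_nonneg _) zero_le_one, one_pow, EuclideanSpace.norm_sq_eq]
    have : ∀ g, ‖(if m g = k then (u : ℂ)⁻¹ * A g else 0)‖ ^ 2 =
        (u ^ 2)⁻¹ * if m g = k then ‖A g‖ ^ 2 else 0 := by
      intro g
      split_ifs
      · rw [norm_mul, norm_inv, Complex.norm_real, Real.norm_of_nonneg hu.le, mul_pow, inv_pow]
      · simp
    rw [Finset.sum_congr rfl fun g _ => this g, ← Finset.mul_sum, hgood, hu2, inv_mul_cancel₀]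
    rw [← hu2]
    positivity
  · have hterm : ∀ g, ∑ o, ‖(if o = m g then (1 : ℂ) else 0) * A g -
        (if o = k then (1 : ℂ) else 0) * (if m g = k then (u : ℂ)⁻¹ * A g else 0)‖ ^ 2 =
        (if m g = k then 0 else ‖A g‖ ^ 2) +
          (1 - u⁻¹) ^ 2 * (if m g = k then ‖A g‖ ^ 2 else 0) := by
      intro g
      by_cases h : m g = k
      · rw [Finset.sum_eq_single k (fun o _ ho => by simp [ho, h]) (by simp)]
        simp only [h, if_true, one_mul, zero_add]
        rw [show A g - (u : ℂ)⁻¹ * A g = ((1 - u⁻¹ : ℝ) : ℂ) * A g by push_cast; ring, norm_mul,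
          Complex.norm_real, mul_pow, Real.norm_eq_abs, sq_abs]
      · rw [Finset.sum_eq_single (m g) (fun o _ ho => by simp [ho, h]) (by simp)]
        simp [h]
    rw [Fintype.sum_prod_type_right]
    simp only
    rw [Finset.sum_congr rfl fun g _ => hterm g, Finset.sum_add_distrib, ← Finset.mul_sum, hgood,
      ← hp, ← hu2]
    have e : (1 - u⁻¹) ^ 2 * u ^ 2 = (u - 1) ^ 2 := by field_simp
    rw [e]
    -- With u² = 1 - p the error p + (u - 1)² equals 2p/(1 + u). Since p ≤ 0.64 forces u ≥ 0.6, it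
    -- is at most 1.25 p, below the stated constant.
    nlinarith

/-! ### Correctness of the protocol -/

theorem channel_standardPhaseEstimation {n : ℕ} {α δ : ℝ} {D : ℕ} {U : Matrix (Fin D) (Fin D) ℂ}
    {ψ : OrthonormalBasis (Fin D) ℂ (EuclideanSpace ℂ (Fin D))} {lam : Fin D → ℝ}
    (h : RoundingPromise n α U ψ lam) :
    (standardPhaseEstimation n α δ).channel U = conjChannel (sectorMap ψ fun j
      (x : Bits (Fin n) × Bits (Fin (repetitions (gap α) δ * (n + extraBits α)))) =>
      (if x.1 = encode n (medianOf (repetitions (gap α) δ) (n + extraBits α) (extraBits α) x.2)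
        then (1 : ℂ) else 0) *
      jointState (repetitions (gap α) δ) (n + extraBits α) ((1 + 2 ^ extraBits α * α) / 2)
        (Complex.exp (2 * Real.pi * Complex.I * lam j)) x.2) := by
  have hU : ∀ j, U.mulVec (ψ j).ofLp =
      Complex.exp (2 * Real.pi * Complex.I * lam j) • (ψ j).ofLp := by
    intro j
    rw [h.decomposition]
    exact spectralSum_mulVec ψ _ j
  have hU' : ∀ j, U.conjTranspose.mulVec (ψ j).ofLp =
      star (Complex.exp (2 * Real.pi * Complex.I * lam j)) • (ψ j).ofLp := by
    intro j
    rw [h.decomposition, conjTranspose_spectralSum]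
    exact spectralSum_mulVec ψ _ j
  refine (EstimationCircuit.channel_eq_conjChannel _ U).trans ?_
  congr 1
  ext p i
  rw [Matrix.of_apply, EstimationCircuit.run_eq_sectorMap _ hU hU', sectorMap, sectorMap,
    Matrix.mul_apply, Matrix.mul_apply]
  refine Finset.sum_congr rfl fun j _ => ?_
  congr 1
  simp only [Matrix.of_apply]
  congr 1
  exact actList_standardPhaseEstimation _ _ _ _ _

theorem isPhaseEstimator_standardPhaseEstimation :
    IsPhaseEstimatorWithPhasesAndGarbage standardPhaseEstimation := by
  intro n α δ _ h0 h1 hδ D U ψ lam hU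
  rw [channel_standardPhaseEstimation hU]
  change ∃ (φ : Fin D → ℝ) (gar : Fin D → EuclideanSpace ℂ
      (Bits (Fin (repetitions (gap α) δ * (n + extraBits α))))), (∀ j, ‖gar j‖ = 1) ∧
    diamondNorm (conjChannel _ - conjChannel (idealIsometry n
      (repetitions (gap α) δ * (n + extraBits α)) ψ lam φ gar)) ≤ ENNReal.ofReal δ
  set M := repetitions (gap α) δ with hM
  set r := extraBits α with hr
  have hω : ∀ j, ‖Complex.exp (2 * Real.pi * Complex.I * lam j)‖ = 1 := by
    intro j
    rw [show 2 * Real.pi * Complex.I * lam j = ((2 * Real.pi * lam j : ℝ) : ℂ) * Complex.I by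
      push_cast; ring]
    exact Complex.norm_exp_ofReal_mul_I _
  have hW := sectorMap_isometry ψ fun j => (sum_norm_sq_graph
    (jointState M (n + r) ((1 + 2 ^ r * α) / 2) (Complex.exp (2 * Real.pi * Complex.I * lam j)))
    fun g => encode n (medianOf M (n + r) r g)).trans (sum_norm_sq_jointState _ _ _ (hω j))
  have hV : ∀ gar : Fin D → EuclideanSpace ℂ (Bits (Fin (M * (n + r)))), (∀ j, ‖gar j‖ = 1) →
      ∀ j, ∑ x : Bits (Fin n) × Bits (Fin (M * (n + r))),
        ‖(if x.1 = encode n ⌊2 ^ n * lam j⌋₊ then (1 : ℂ) else 0) * gar j x.2‖ ^ 2 = 1 := by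
    intro gar hgar j
    have := sum_norm_sq_graph (gar j).ofLp (fun _ => encode n ⌊2 ^ n * lam j⌋₊)
    rw [this, ← EuclideanSpace.norm_sq_eq, hgar, one_pow]
  have hI : ∀ gar : Fin D → EuclideanSpace ℂ (Bits (Fin (M * (n + r)))),
      idealIsometry n (M * (n + r)) ψ lam (fun _ => 0) gar = sectorMap ψ fun j x =>
        (if x.1 = encode n ⌊2 ^ n * lam j⌋₊ then (1 : ℂ) else 0) * gar j x.2 := by
    intro gar
    rw [idealIsometry_eq_sectorMap]
    simp
  -- For δ ≥ 2 any garbage will do; this also covers the values of δ for which no estimates are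
  -- made.
  rcases le_or_gt 2 δ with h2 | h2
  · have hgar : ∀ _ : Fin D, ‖(EuclideanSpace.single (fun _ => false) 1 :
      EuclideanSpace ℂ (Bits (Fin (M * (n + r)))))‖ = 1 := fun _ => by simp
    refine ⟨fun _ => 0, fun _ => EuclideanSpace.single (fun _ => false) 1, hgar, ?_⟩
    rw [hI]
    exact (diamondNorm_conjChannel_sub_le_two _ _ hW (sectorMap_isometry ψ (hV _ hgar))).trans
      (ENNReal.ofReal_le_ofReal h2)
  · have hfail : ∀ j, ∑ g, (if encode n (medianOf M (n + r) r g) = encode n ⌊2 ^ n * lam j⌋₊ then 0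
        else ‖jointState M (n + r) ((1 + 2 ^ r * α) / 2)
          (Complex.exp (2 * Real.pi * Complex.I * lam j)) g‖ ^ 2) ≤ deltaMed δ := by
      intro j
      have hlam := hU.range j
      have hN : (0 : ℝ) < 2 ^ n := by positivity
      have hnn : 0 ≤ 2 ^ n * lam j := mul_nonneg hN.le hlam.1
      have hk : ⌊2 ^ n * lam j⌋₊ < 2 ^ n := by
        rw [Nat.floor_lt hnn]
        push_cast
        nlinarith [hlam.2]
      -- The promise is used only at x = ⌊2^n λ⌋.
      have hkl : (⌊2 ^ n * lam j⌋₊ : ℝ) + α < 2 ^ n * lam j := by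
        by_contra hcon
        refine hU.avoids j ⌊2 ^ n * lam j⌋₊ hk.le ⟨?_, ?_⟩
        · rw [div_le_iff₀' hN]
          exact Nat.floor_le hnn
        · rw [← add_div, le_div_iff₀' hN]
          exact not_lt.1 hcon
      have hq := half_add_gap_le_hitProb n h0 h1 hk hkl (Nat.lt_floor_add_one _)
      -- Equal medians have equal encodings, so failures of the encoding are among failures of the
      -- median; injectivity of `encode` plays no role.
      refine le_trans (Finset.sum_le_sum fun g _ => ?_) ((median_failure_le M (n + r) r _ (hω j)
        (gap_pos h1).le (gap_lt_half h1) hq).trans (exp_repetitions_le (gap_pos h1) hδ))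
      split_ifs with ha hb hb
      · exact le_rfl
      · positivity
      · exact absurd (by rw [hb]) ha
      · exact le_rfl
    have hε : deltaMed δ ≤ 0.64 := by
      rw [deltaMed, div_le_iff₀ (by norm_num)]
      nlinarith
    choose gar hgar hdist using fun j => exists_normalized_projection
      (sum_norm_sq_jointState M (n + r) _ (hω j)) _ _ (hfail j) hε
    refine ⟨fun _ => 0, gar, hgar, ?_⟩
    rw [hI]
    refine (diamondNorm_conjChannel_sub_le _ _ hW (sectorMap_isometry ψ (hV _ hgar))
      (c := 1.5625 * deltaMed δ) ?_).trans (ENNReal.ofReal_le_ofReal ?_)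
    · rw [sectorMap_sub]
      exact posSemidef_sub_sectorMap ψ hdist
    -- 1.5625 = 6.25 / 4 is chosen so that 2√c is exactly δ.
    · rw [show 1.5625 * deltaMed δ = (δ / 2) ^ 2 by rw [deltaMed]; ring,
        Real.sqrt_sq (by positivity)]
      linarith

/-! ### Query and garbage counts -/

theorem queries_standardPhaseEstimation (n : ℕ) (α δ : ℝ) :
    (standardPhaseEstimation n α δ).queries =
      (2 ^ (n + extraBits α) - 1) * repetitions (gap α) δ := by
  have h1 : ∀ (M b : ℕ) (s : ℝ) (l : Fin M),
      (estimateGates n M b s l).countP Gate.isQuery = 2 ^ b - 1 := by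
    intro M b s l
    rw [estimateGates, List.countP_append, List.countP_append, List.countP_flatMap]
    have e1 : ((List.finRange b).map fun i : Fin b => Gate.localUnitary
        ⟨fun _ : Fin 1 => estimateQubit n M b l i, fun _ _ _ => Subsingleton.elim _ _⟩
        ⟨hadamardMatrix, hadamardMatrix_mem⟩).countP Gate.isQuery = 0 := by
      rw [List.countP_eq_zero]
      simp [Gate.isQuery]
    have e2 : (List.map (List.countP Gate.isQuery ∘ fun i : Fin b =>
        List.replicate (2 ^ i.val) (Gate.ctrl (estimateQubit n M b l i)))
        (List.finRange b)).sum = 2 ^ b - 1 := by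
      rw [← List.ofFn_eq_map, List.sum_ofFn]
      simp only [Function.comp_apply, List.countP_replicate, Gate.isQuery, if_true]
      rw [Fin.sum_univ_eq_sum_range (fun i => 2 ^ i), Nat.geomSum_eq le_rfl]
      simp
    rw [e1, e2]
    simp [Gate.isQuery]
  rw [EstimationCircuit.queries, standardPhaseEstimation]
  simp only [List.countP_append, List.countP_flatMap]
  rw [show (List.countP Gate.isQuery ∘ estimateGates n (repetitions (gap α) δ) (n + extraBits α)
    ((1 + 2 ^ extraBits α * α) / 2)) = fun _ => 2 ^ (n + extraBits α) - 1 from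
      funext fun l => h1 _ _ _ l]
  simp [Gate.isQuery, mul_comm]

end PhaseEstimation

theorem mainTheorem7 :
    PhaseEstimation.IsPhaseEstimatorWithPhasesAndGarbage PhaseEstimation.standardPhaseEstimation ∧
    ∀ (n : ℕ) (α δ : ℝ), 1 ≤ n → 0 < α → α < 1 → 0 < δ →
      (α ≤ 1 / 2 →
        (PhaseEstimation.standardPhaseEstimation n α δ).queries =
          (2 ^ (n + ⌈Real.logb 2 (1 / (2 * α))⌉₊) - 1) *
            ⌈Real.log (PhaseEstimation.deltaMed δ)⁻¹ / (2 * PhaseEstimation.etaZero ^ 2)⌉₊ ∧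
        (PhaseEstimation.standardPhaseEstimation n α δ).garbage =
          (n + ⌈Real.logb 2 (1 / (2 * α))⌉₊) *
            ⌈Real.log (PhaseEstimation.deltaMed δ)⁻¹ / (2 * PhaseEstimation.etaZero ^ 2)⌉₊) ∧
      (1 / 2 < α →
        (PhaseEstimation.standardPhaseEstimation n α δ).queries =
          (2 ^ n - 1) * ⌈Real.log (PhaseEstimation.deltaMed δ)⁻¹ /
            (2 * (PhaseEstimation.gam ((1 - α) / 2) - 1 / 2) ^ 2)⌉₊ ∧
        (PhaseEstimation.standardPhaseEstimation n α δ).garbage =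
          n * ⌈Real.log (PhaseEstimation.deltaMed δ)⁻¹ /
            (2 * (PhaseEstimation.gam ((1 - α) / 2) - 1 / 2) ^ 2)⌉₊) := by
  refine ⟨PhaseEstimation.isPhaseEstimator_standardPhaseEstimation, fun n α δ _ _ _ _ => ?_⟩
  have hg : (PhaseEstimation.standardPhaseEstimation n α δ).garbage =
      (n + PhaseEstimation.extraBits α) *
        PhaseEstimation.repetitions (PhaseEstimation.gap α) δ := mul_comm _ _
  rw [hg, PhaseEstimation.queries_standardPhaseEstimation]
  refine ⟨fun h => ?_, fun h => ?_⟩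
  · rw [PhaseEstimation.gap, if_pos h]
    exact ⟨rfl, rfl⟩
  · rw [PhaseEstimation.gap, if_neg (not_le.2 h), PhaseEstimation.extraBits_of_half_lt h]
    exact ⟨rfl, rfl⟩
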